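/- A one-counter automaton (OCA) is a tuple $\mathcal{A}=(Q,\Sigma,\iota,F,m,\Delta)$ with a finite set $Q$ of states, a nonempty finite alphabet $\Sigma$, an initial state $\iota\in Q$, a set $F\subseteq Q$ of final states, a threshold $m\in\mathbb{N}$ and a transition relation $\Delta\subseteq Q\times\{0,\dots,m\}\times(\Sigma\uplus\{\mathrm{inc},\mathrm{dec}\})\times Q$. Its size is $|Q|+|\Sigma|+m+|\Delta|$. It is deterministic if for all $q\in Q$, $k\in\{0,\dots,m\}$ and $\sigma\in\Sigma\uplus\{\mathrm{inc},\mathrm{dec}\}$ there is exactly one $q'\in Q$ with $(q,k,\sigma,q')\in\Delta$. A configuration is a pair $(q,x)\in Q\times\mathbb{N}$ of a state and a counter value. A transition $(q,k,\sigma,q')$ can be taken in $(q,x)$ if $k=\min\{x,m\}$ and, in case $\sigma=\mathrm{dec}$, if $x\geq 1$; it leads to $(q',x+1)$ if $\sigma=\mathrm{inc}$, to $(q',x-1)$ if $\sigma=\mathrm{dec}$, and to $(q',x)$ if $\sigma\in\Sigma$, and in the last case it outputs the pair $(\sigma,x)$, while $\mathrm{inc}$ and $\mathrm{dec}$ output nothing.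 The observability language $L_{\mathrm{obs}}(\mathcal{A})\subseteq(\Sigma\times\mathbb{N})^*$ is the set of the output words of all finite runs from $(\iota,0)$ to a configuration whose state is in $F$. **Theorem (complementability).** There are an algorithm and a polynomial $p$ such that, given any OCA $\mathcal{A}$, with alphabet $\Sigma$ and of size $n$, the algorithm computes in at most $2^{p(n)}$ steps a deterministic OCA $\bar{\mathcal{A}}$ with the same alphabet $\Sigma$ such that $$L_{\mathrm{obs}}(\bar{\mathcal{A}})=(\Sigma\times\mathbb{N})^*\setminus L_{\mathrm{obs}}(\mathcal{A}).$$ Moreover, for every nonempty finite alphabet $\Sigma$, the class of the observability languages of OCAs over $\Sigma$ is closed under complement in $(\Sigma\times\mathbb{N})^*$, intersection and union. -/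

import Mathlib

universe u v

/-! ## One-counter automata -/

/-- The counter operations: increment and decrement. -/
inductive Op where
  | inc
  | dec

/-- What a transition carries: a letter of the alphabet or a counter operation. -/
abbrev OCA.Symbol (α : Type v) : Type v := α ⊕ Op

/-- What a run shows at one step: a letter with the current counter value, or a counter
operation. -/
abbrev OCA.Label (α : Type v) : Type v := (α × ℕ) ⊕ Op

/-- A one-counter automaton with set of states `Q` and alphabet `α` (both are finite wherever
automata are used). A transition `(q, k, σ, q')` carries a counter test `k ∈ {0, …, threshold}`. -/
structure OCA (Q : Type u) (α : Type v) where
  start : Q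
  final : Set Q
  threshold : ℕ
  trans : Set (Q × Fin (threshold + 1) × OCA.Symbol α × Q)

namespace OCA

variable {Q : Type u} {α : Type v}

/-- `|Q| + |Σ| + m + |Δ|`. -/
noncomputable def size (A : OCA Q α) : ℕ :=
  Nat.card Q + Nat.card α + A.threshold + A.trans.ncard

/-- The only counter test that the counter value `x` passes, `min x m`. -/
def test (A : OCA Q α) (x : ℕ) : Fin (A.threshold + 1) :=
  ⟨min x A.threshold, Nat.lt_succ_of_le (min_le_right _ _)⟩

/-- The global transition relation on configurations `(state, counter value)`. A decrement is
possible only at a positive counter value. -/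
inductive Step (A : OCA Q α) : Q × ℕ → Label α → Q × ℕ → Prop
  | inc {q q' : Q} {x : ℕ} (h : (q, A.test x, Sum.inr Op.inc, q') ∈ A.trans) :
      Step A (q, x) (Sum.inr Op.inc) (q', x + 1)
  | dec {q q' : Q} {x : ℕ} (h : (q, A.test (x + 1), Sum.inr Op.dec, q') ∈ A.trans) :
      Step A (q, x + 1) (Sum.inr Op.dec) (q', x)
  | letter {q q' : Q} {x : ℕ} {a : α} (h : (q, A.test x, Sum.inl a, q') ∈ A.trans) :
      Step A (q, x) (Sum.inl (a, x)) (q', x)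

/-- `A.PartialRun c τ c'`: there is a partial run from `c` to `c'` with trace `τ`. -/
inductive PartialRun (A : OCA Q α) : Q × ℕ → List (Label α) → Q × ℕ → Prop
  | nil (c : Q × ℕ) : PartialRun A c [] c
  | cons {c c' c'' : Q × ℕ} {l : Label α} {τ : List (Label α)}
      (h : A.Step c l c') (t : PartialRun A c' τ c'') : PartialRun A c (l :: τ) c''

/-- The observation of one step: letters are seen together with the counter value, counter
operations are not seen. -/
def obs : Label α → List (α × ℕ)
  | Sum.inl p => [p]
  | Sum.inr _ => []

/-- The language with counter observability, a set of words over `Σ × ℕ`. -/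
def obsLanguage (A : OCA Q α) : Set (List (α × ℕ)) :=
  {w | ∃ (τ : List (Label α)) (c : Q × ℕ),
    A.PartialRun (A.start, 0) τ c ∧ c.1 ∈ A.final ∧ τ.flatMap obs = w}

/-- Determinism: exactly one successor state for every state, counter test and symbol. -/
def Deterministic (A : OCA Q α) : Prop :=
  ∀ (q : Q) (k : Fin (A.threshold + 1)) (σ : Symbol α), ∃! q' : Q, (q, k, σ, q') ∈ A.trans

/-! ### Automata as inputs and outputs of algorithms -/

open Classical in
/-- The truth value of `P` as a bit. -/
noncomputable def bit (P : Prop) : ℕ := if P then 1 else 0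

/-- The symbols in their order: the letters as numbered by `e`, then increment and decrement. -/
def symbols {s : ℕ} (e : α ≃ Fin s) : List (Symbol α) :=
  (List.finRange s).map (fun i => Sum.inl (e.symm i)) ++ [Sum.inr Op.inc, Sum.inr Op.dec]

/-- The encoding of an automaton, for a numbering of its states and of its letters: the numbers
`|Q|`, `|Σ|`, `m` and that of the initial state, the bits of the characteristic function of the
final states, and those of the characteristic function of the transition relation, with
`(q, k, σ, q')` in lexicographic order. -/
noncomputable def encode (A : OCA Q α) {n s : ℕ} (eQ : Q ≃ Fin n) (eA : α ≃ Fin s) : List ℕ :=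
  [n, s, A.threshold, (eQ A.start : ℕ)] ++
  (List.finRange n).map (fun i => bit (eQ.symm i ∈ A.final)) ++
  (List.finRange n).flatMap fun i =>
    (List.finRange (A.threshold + 1)).flatMap fun k =>
      (symbols eA).flatMap fun σ =>
        (List.finRange n).map fun j => bit ((eQ.symm i, k, σ, eQ.symm j) ∈ A.trans)

end OCA

/-- A language over `Σ × ℕ` that is the observability language of some OCA over `Σ`. -/
def IsOCAObservable {α : Type v} (L : Set (List (α × ℕ))) : Prop :=
  ∃ (n : ℕ) (A : OCA (Fin n) α), A.obsLanguage = L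

/-! ## Random access machines with step count -/

namespace RAM

/-- Programs of a successor random access machine with registers `X₀, X₁, …` that hold natural
numbers, an input list of numbers and an output list of numbers. Arithmetic is by `+ 1` and
`- 1` only, so that in `t` steps no number grows by more than `t`. -/
inductive Program where
  /-- `X_r := c` -/
  | const (r c : ℕ)
  /-- `X_r := X_r + 1` -/
  | succ (r : ℕ)
  /-- `X_r := X_r - 1`, and `0` remains `0` -/
  | pred (r : ℕ)
  /-- `X_r := X_r'` -/
  | copy (r r' : ℕ)
  /-- `X_r := X_(X_r')` -/
  | load (r r' : ℕ)
  /-- `X_(X_r) := X_r'` -/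
  | store (r r' : ℕ)
  /-- move the next number of the input to `X_r`; set `X_r := 0` if there is none -/
  | read (r : ℕ)
  /-- append `X_r` to the output -/
  | print (r : ℕ)
  /-- one program after the other -/
  | seq (P P' : Program)
  /-- if `X_r = 0` then `P` else `P'` -/
  | ifZero (r : ℕ) (P P' : Program)
  /-- while `X_r ≠ 0` do `P` -/
  | whileNonzero (r : ℕ) (P : Program)

/-- A state: the rest of the input, the contents of the registers, the output so far. -/
structure State where
  input : List ℕ
  reg : ℕ → ℕ
  output : List ℕ

/-- The state with the number `x` written to register `r`. -/
def State.set (S : State) (r x : ℕ) : State :=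
  { S with reg := Function.update S.reg r x }

/-- `Exec P S t S'`: started in `S`, the program `P` halts in `S'` after exactly `t` steps. An
elementary instruction takes one step, and so does each evaluation of the test of a conditional
or of a loop. -/
inductive Exec : Program → State → ℕ → State → Prop
  | const (r c : ℕ) (S : State) : Exec (.const r c) S 1 (S.set r c)
  | succ (r : ℕ) (S : State) : Exec (.succ r) S 1 (S.set r (S.reg r + 1))
  | pred (r : ℕ) (S : State) : Exec (.pred r) S 1 (S.set r (S.reg r - 1))
  | copy (r r' : ℕ) (S : State) : Exec (.copy r r') S 1 (S.set r (S.reg r'))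
  | load (r r' : ℕ) (S : State) : Exec (.load r r') S 1 (S.set r (S.reg (S.reg r')))
  | store (r r' : ℕ) (S : State) : Exec (.store r r') S 1 (S.set (S.reg r) (S.reg r'))
  | read (r : ℕ) (S : State) :
      Exec (.read r) S 1 { S.set r S.input.headI with input := S.input.tail }
  | print (r : ℕ) (S : State) :
      Exec (.print r) S 1 { S with output := S.output ++ [S.reg r] }
  | seq {P P' : Program} {S S' S'' : State} {t t' : ℕ}
      (h : Exec P S t S') (h' : Exec P' S' t' S'') : Exec (.seq P P') S (t + t') S''
  | ifZero_true {r : ℕ} {P P' : Program} {S S' : State} {t : ℕ}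
      (hr : S.reg r = 0) (h : Exec P S t S') : Exec (.ifZero r P P') S (t + 1) S'
  | ifZero_false {r : ℕ} {P P' : Program} {S S' : State} {t : ℕ}
      (hr : S.reg r ≠ 0) (h : Exec P' S t S') : Exec (.ifZero r P P') S (t + 1) S'
  | while_done {r : ℕ} {P : Program} {S : State}
      (hr : S.reg r = 0) : Exec (.whileNonzero r P) S 1 S
  | while_step {r : ℕ} {P : Program} {S S' S'' : State} {t t' : ℕ}
      (hr : S.reg r ≠ 0) (h : Exec P S t S') (h' : Exec (.whileNonzero r P) S' t' S'') :
      Exec (.whileNonzero r P) S (t + t' + 1) S''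

/-- On the given input, and with all registers `0` at the start, the program halts after at most
`T` steps with the given output. -/
def OutputsWithin (P : Program) (input output : List ℕ) (T : ℕ) : Prop :=
  ∃ t ≤ T, ∃ S : State, Exec P ⟨input, fun _ => 0, []⟩ t S ∧ S.output = output

end RAM

/-! An observed word fixes the counter value at every letter; only the silent increments and
decrements between letters are free. A subset construction thus has to track the set of states
reachable with observation `w` at counter value `x`. If `x` is at least the counter value at the
last letter, a silent path to `x + 1` splits at its first increment from `x`
(`Silent.Path.exists_inc`). So the set at `x + 1` is the image of the set at `x` under one increment
followed by `Flat (x + 1)`, the relation of all silent paths from level `x + 1` to itself; downwards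
it is the same (`Silent.Path.exists_dec`). The deterministic automaton can therefore go straight up
or straight down to the next letter, all detours being absorbed into `Flat`.

`Flat x` is generated by excursions above and below `x` (`Silent.path_iff_flat`). Those above do not
depend on `x` from the threshold on. Those below obey a recursion in `x` whose step is constant
beyond the threshold; as there are only finitely many relations on the states, they are ultimately
periodic (`NumOCA.period_spec`, `NumOCA.flat_congr`). A larger threshold, together with the residue
of the counter value kept in the state, determines `Flat x`.

A run may end with silent moves, so an extra state `d.n` is added that is entered from final states
and then moves freely: a word is accepted iff `d.n` is reachable at the counter value of its last
letter (`OCA.mem_obsLanguage_iff_reach`). The deterministic automaton accepts right after a letter,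
or at the start, if its set does not contain `d.n`. A mode in the state sends every reversal of
direction between letters to failure. Hence the invariant `NumOCA.Inv` holds along all runs, and
`NumOCA.exists_run` gives a run without reversals for every word.

For the running time, computations are polynomial in the values of the numbers involved, one of
which is `2 ^ d.len`, with `d.len` the number of bits of the encoding. This leaves enough time to
compute closures by trying all sets of states, or all relations, instead of iterating. Closure under
union comes from a new initial state, under intersection from De Morgan. -/

namespace RAM

/-! ### Contexts of finitely many numbers and polynomial bounds -/

/-- A type whose elements are presented by the contents of `dim` registers. -/
class Ctx (σ : Type*) where
  dim : ℕ
  val : σ → ℕ → ℕ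

instance {σ : Type*} [Ctx σ] : Ctx (σ × ℕ) where
  dim := Ctx.dim σ + 1
  val x i := if i < Ctx.dim σ then Ctx.val x.1 i else x.2

section Bounds

variable {σ : Type*} [Ctx σ]

/-- The largest number in the presentation of `x`. -/
def height (x : σ) : ℕ := (Finset.range (Ctx.dim σ)).sup (Ctx.val x)

theorem height_prod (x : σ) (v : ℕ) : height (x, v) = max (height x) v := by
  have h : ∀ i ∈ Finset.range (Ctx.dim σ), Ctx.val (x, v) i = Ctx.val x i := fun i hi => by
    simp [Ctx.val, Finset.mem_range.1 hi]
  have h2 : Ctx.val (x, v) (Ctx.dim σ) = v := by simp [Ctx.val]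
  have h1 : Ctx.dim (σ × ℕ) = Ctx.dim σ + 1 := rfl
  rw [height, height, h1, Finset.range_add_one, Finset.sup_insert, h2, Finset.sup_congr rfl h,
    sup_comm]

theorem val_le_height (x : σ) {i : ℕ} (hi : i < Ctx.dim σ) : Ctx.val x i ≤ height x :=
  Finset.le_sup (f := Ctx.val x) (Finset.mem_range.2 hi)

/-- `f` is bounded by a polynomial in the numbers that present its argument. -/
def PolyBdd (f : σ → ℕ) : Prop := ∃ c, ∀ x, f x ≤ (height x + 2) ^ c

namespace PolyBdd

variable {f g b : σ → ℕ}

theorem mono (hg : PolyBdd g) (h : ∀ x, f x ≤ g x) : PolyBdd f :=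
  hg.imp fun _ hc x => (h x).trans (hc x)

theorem const (c : ℕ) : PolyBdd (fun _ : σ => c) :=
  ⟨c, fun x => Nat.lt_two_pow_self.le.trans (Nat.pow_le_pow_left (by omega) c)⟩

protected theorem height : PolyBdd (height : σ → ℕ) := ⟨1, fun x => by simp⟩

theorem mul (hf : PolyBdd f) (hg : PolyBdd g) : PolyBdd (fun x => f x * g x) := by
  obtain ⟨a, ha⟩ := hf
  obtain ⟨b, hb⟩ := hg
  exact ⟨a + b, fun x => by rw [pow_add]; exact Nat.mul_le_mul (ha x) (hb x)⟩

theorem max (hf : PolyBdd f) (hg : PolyBdd g) : PolyBdd (fun x => max (f x) (g x)) := by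
  obtain ⟨a, ha⟩ := hf
  obtain ⟨b, hb⟩ := hg
  refine ⟨a + b, fun x => max_le ((ha x).trans ?_) ((hb x).trans ?_)⟩ <;>
  exact Nat.pow_le_pow_right (by omega) (by omega)

theorem add (hf : PolyBdd f) (hg : PolyBdd g) : PolyBdd (fun x => f x + g x) :=
  ((const 2).mul (hf.max hg)).mono fun x => by omega

theorem pow (hf : PolyBdd f) (k : ℕ) : PolyBdd (fun x => f x ^ k) := by
  obtain ⟨a, ha⟩ := hf
  exact ⟨a * k, fun x => by rw [pow_mul]; exact Nat.pow_le_pow_left (ha x) k⟩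

theorem fst (hf : PolyBdd f) : PolyBdd (fun x : σ × ℕ => f x.1) := by
  obtain ⟨a, ha⟩ := hf
  refine ⟨a, fun x => (ha x.1).trans (Nat.pow_le_pow_left ?_ a)⟩
  have : height x = Max.max (height x.1) x.2 := height_prod x.1 x.2
  omega

/-- The bounds `(height + 2) ^ c` are monotone in the numbers, so a bound on the last number yields
one bound for all its values. This controls the cost of a loop body uniformly over the iterations.
-/
theorem exists_uniform {g : σ × ℕ → ℕ} (hg : PolyBdd g) (hb : PolyBdd b) :
    ∃ G : σ → ℕ, PolyBdd G ∧ ∀ x v, v ≤ b x → g (x, v) ≤ G x := by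
  obtain ⟨a, ha⟩ := hg
  refine ⟨_, ((PolyBdd.height.max hb).add (const 2)).pow a, fun x v hv => (ha _).trans ?_⟩
  refine Nat.pow_le_pow_left ?_ a
  rw [height_prod]
  omega

theorem comp {g : σ × ℕ → ℕ} (hg : PolyBdd g) (hf : PolyBdd f) :
    PolyBdd (fun x => g (x, f x)) := by
  obtain ⟨G, hG, h⟩ := hg.exists_uniform hf
  exact hG.mono fun x => h x _ le_rfl

end PolyBdd

end Bounds

/-! ### Executions with a time bound and a postcondition -/

/-- Started in `S`, the program `P` halts within `T` steps in a state that satisfies `post`. -/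
def Runs (P : Program) (S : State) (T : ℕ) (post : State → Prop) : Prop :=
  ∃ t ≤ T, ∃ S', Exec P S t S' ∧ post S'

namespace Runs

variable {P P' : Program} {S : State} {T T' : ℕ} {post post' : State → Prop}

theorem of_exec {S' : State} (h : Exec P S 1 S') (hp : post S') : Runs P S 1 post :=
  ⟨1, le_rfl, S', h, hp⟩

theorem mono (h : Runs P S T post) (hT : T ≤ T') (hp : ∀ S', post S' → post' S') :
    Runs P S T' post' := by
  obtain ⟨t, ht, S', he, hS⟩ := h
  exact ⟨t, ht.trans hT, S', he, hp S' hS⟩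

theorem seq (h : Runs P S T (fun S' => Runs P' S' T' post)) :
    Runs (.seq P P') S (T + T') post := by
  obtain ⟨t, ht, S', he, t', ht', S'', he', hp⟩ := h
  exact ⟨t + t', by omega, S'', .seq he he', hp⟩

theorem ifZero_of_eq {r : ℕ} (hr : S.reg r = 0) (h : Runs P S T post) :
    Runs (.ifZero r P P') S (T + 1) post := by
  obtain ⟨t, ht, S', he, hp⟩ := h
  exact ⟨t + 1, by omega, S', .ifZero_true hr he, hp⟩

theorem ifZero_of_ne {r : ℕ} (hr : S.reg r ≠ 0) (h : Runs P' S T post) :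
    Runs (.ifZero r P P') S (T + 1) post := by
  obtain ⟨t, ht, S', he, hp⟩ := h
  exact ⟨t + 1, by omega, S', .ifZero_false hr he, hp⟩

/-- `inv k` is the invariant with `k` iterations to go, so the number of iterations is fixed in
advance. Each one costs the body and a test; the final `1` is the failing test. -/
theorem whileNonzero {r B : ℕ} (inv : ℕ → State → Prop)
    (hstep : ∀ k S, inv (k + 1) S → S.reg r ≠ 0 ∧ Runs P S B (inv k))
    (hdone : ∀ S, inv 0 S → S.reg r = 0) (n : ℕ) (h : inv n S) :
    Runs (.whileNonzero r P) S (n * (B + 1) + 1) (inv 0) := by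
  induction n generalizing S with
  | zero => exact ⟨1, by omega, S, .while_done (hdone S h), h⟩
  | succ n ih =>
    obtain ⟨hr, t, ht, S', he, hS'⟩ := hstep n S h
    obtain ⟨t', ht', S'', he', hS''⟩ := ih hS'
    refine ⟨t + t' + 1, ?_, S'', .while_step hr he he', hS''⟩
    rw [Nat.succ_mul]
    omega

end Runs

/-- The states agree on the input, the output and the registers below `o`. -/
def Keeps (o : ℕ) (S S' : State) : Prop :=
  (∀ r < o, S'.reg r = S.reg r) ∧ S'.input = S.input ∧ S'.output = S.output

theorem Keeps.trans {o o' : ℕ} {S S' S'' : State} (h : Keeps o S S') (h' : Keeps o' S' S'')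
    (ho : o ≤ o') : Keeps o S S'' :=
  ⟨fun r hr => (h'.1 r (by omega)).trans (h.1 r hr), h'.2.1.trans h.2.1, h'.2.2.trans h.2.2⟩

theorem Keeps.set (S : State) {o r : ℕ} (h : o ≤ r) (x : ℕ) : Keeps o S (S.set r x) :=
  ⟨fun r' hr' => by simp [State.set, Function.update_of_ne (show r' ≠ r by omega)], rfl, rfl⟩

theorem reg_set_self (S : State) (r x : ℕ) : (S.set r x).reg r = x := by simp [State.set]

theorem reg_set_of_ne (S : State) {r r' : ℕ} (h : r' ≠ r) (x : ℕ) :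
    (S.set r x).reg r' = S.reg r' := by simp [State.set, h]

/-! ### Functions of register contents computable in polynomial time. -/

section Computable

variable {σ : Type*} [Ctx σ]

/-- The registers `loc 0, loc 1, …` of `S` present `x`. -/
def Holds (x : σ) (loc : ℕ → ℕ) (S : State) : Prop :=
  ∀ i < Ctx.dim σ, S.reg (loc i) = Ctx.val x i

theorem Holds.of_keeps {x : σ} {loc : ℕ → ℕ} {S S' : State} {o : ℕ} (h : Holds x loc S)
    (hloc : ∀ i < Ctx.dim σ, loc i < o) (hk : Keeps o S S') : Holds x loc S' :=
  fun i hi => (hk.1 _ (hloc i hi)).trans (h i hi)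

/-- The locations of a context that is extended by the register `o`. -/
def extend (σ : Type*) [Ctx σ] (loc : ℕ → ℕ) (o : ℕ) (i : ℕ) : ℕ :=
  if i < Ctx.dim σ then loc i else o

theorem extend_lt {loc : ℕ → ℕ} {o o' : ℕ} (hloc : ∀ i < Ctx.dim σ, loc i < o')
    (ho : o < o') : ∀ i < Ctx.dim (σ × ℕ), extend σ loc o i < o' := fun i _ => by
  unfold extend
  split_ifs with h
  exacts [hloc i h, ho]

theorem Holds.extend {x : σ} {loc : ℕ → ℕ} {S : State} {o v : ℕ} (h : Holds x loc S)
    (hv : S.reg o = v) : Holds (x, v) (extend σ loc o) S := fun i _ => by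
  by_cases hi : i < Ctx.dim σ
  · simp [RAM.extend, hi, Ctx.val, h i hi]
  · simp [RAM.extend, hi, Ctx.val, hv]

/-- `P` computes `f` from the registers `loc`, with the result in register `o` and all registers
below `o` unchanged, in time `T`. -/
def Computes (P : Program) (f T : σ → ℕ) (loc : ℕ → ℕ) (o : ℕ) : Prop :=
  ∀ (x : σ) (S : State), Holds x loc S → Runs P S (T x) fun S' => S'.reg o = f x ∧ Keeps o S S'

/-- `f` has polynomially bounded values and is computable in polynomial time, where the numbers
in the argument count with their values. -/
def PolyTime (f : σ → ℕ) : Prop :=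
  PolyBdd f ∧ ∃ T : σ → ℕ, PolyBdd T ∧ ∀ (loc : ℕ → ℕ) (o : ℕ), (∀ i < Ctx.dim σ, loc i < o) →
    ∃ P, Computes P f T loc o

namespace PolyTime

variable {f g h b : σ → ℕ}

theorem var {i : ℕ} (hi : i < Ctx.dim σ) : PolyTime (fun x : σ => Ctx.val x i) := by
  refine ⟨PolyBdd.height.mono fun x => val_le_height x hi, _, PolyBdd.const 1, fun loc o _ => ?_⟩
  refine ⟨.copy o (loc i), fun x S hS => .of_exec (.copy _ _ _) ⟨?_, Keeps.set S le_rfl _⟩⟩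
  rw [reg_set_self, hS i hi]

theorem snd : PolyTime (fun x : σ × ℕ => x.2) := by
  have := var (σ := σ × ℕ) (i := Ctx.dim σ) (Nat.lt_succ_self _)
  simpa [Ctx.val] using this

theorem const (c : ℕ) : PolyTime (fun _ : σ => c) := by
  refine ⟨PolyBdd.const c, _, PolyBdd.const 1, fun loc o _ => ?_⟩
  exact ⟨.const o c, fun x S _ => .of_exec (.const _ _ _)
    ⟨reg_set_self _ _ _, Keeps.set S le_rfl _⟩⟩

theorem fst (hf : PolyTime f) : PolyTime (fun x : σ × ℕ => f x.1) := by
  obtain ⟨hb, T, hT, H⟩ := hf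
  refine ⟨hb.fst, _, hT.fst, fun loc o hloc => ?_⟩
  obtain ⟨P, hP⟩ := H loc o fun i hi => hloc i (Nat.lt_succ_of_lt hi)
  refine ⟨P, fun x S hS => hP x.1 S fun i hi => ?_⟩
  have := hS i (Nat.lt_succ_of_lt hi)
  simpa [Ctx.val, hi] using this

/-- The value of `f` in register `o` joins the context of `g`, whose program is placed one register
higher. The time bound in `PolyTime` is chosen before the placement, so moving a program does not
change its cost. -/
theorem letIn {g : σ × ℕ → ℕ} (hf : PolyTime f) (hg : PolyTime g) :
    PolyTime (fun x => g (x, f x)) := by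
  obtain ⟨hb, T, hT, H⟩ := hf
  obtain ⟨hb', T', hT', H'⟩ := hg
  refine ⟨hb'.comp hb, _, (hT.add ((hT'.comp hb).add (PolyBdd.const 1))), fun loc o hloc => ?_⟩
  obtain ⟨P, hP⟩ := H loc o hloc
  obtain ⟨P', hP'⟩ := H' (extend σ loc o) (o + 1)
    (extend_lt (fun i hi => (hloc i hi).trans (Nat.lt_succ_self o)) (Nat.lt_succ_self o))
  refine ⟨.seq P (.seq P' (.copy o (o + 1))), fun x S hS => .seq ((hP x S hS).mono le_rfl ?_)⟩
  rintro S' ⟨h1, h2⟩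
  refine .seq ((hP' (x, f x) S' ((hS.of_keeps hloc h2).extend h1)).mono le_rfl ?_)
  rintro S'' ⟨h3, h4⟩
  refine .of_exec (.copy _ _ _) ⟨?_,
    (h2.trans h4 (Nat.le_succ o)).trans (Keeps.set _ le_rfl _) le_rfl⟩
  rw [reg_set_self, h3]

theorem succ (hf : PolyTime f) : PolyTime (fun x => f x + 1) := by
  obtain ⟨hb, T, hT, H⟩ := hf
  refine ⟨hb.add (PolyBdd.const 1), _, hT.add (PolyBdd.const 1), fun loc o hloc => ?_⟩
  obtain ⟨P, hP⟩ := H loc o hloc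
  refine ⟨.seq P (.succ o), fun x S hS => .seq ((hP x S hS).mono le_rfl ?_)⟩
  rintro S' ⟨h1, h2⟩
  refine .of_exec (.succ _ _) ⟨?_, h2.trans (Keeps.set _ le_rfl _) le_rfl⟩
  rw [reg_set_self, h1]

theorem pred (hf : PolyTime f) : PolyTime (fun x => f x - 1) := by
  obtain ⟨hb, T, hT, H⟩ := hf
  refine ⟨hb.mono fun x => Nat.sub_le _ _, _, hT.add (PolyBdd.const 1), fun loc o hloc => ?_⟩
  obtain ⟨P, hP⟩ := H loc o hloc
  refine ⟨.seq P (.pred o), fun x S hS => .seq ((hP x S hS).mono le_rfl ?_)⟩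
  rintro S' ⟨h1, h2⟩
  refine .of_exec (.pred _ _) ⟨?_, h2.trans (Keeps.set _ le_rfl _) le_rfl⟩
  rw [reg_set_self, h1]

theorem ifZero (hf : PolyTime f) (hg : PolyTime g) (hh : PolyTime h) :
    PolyTime (fun x => if f x = 0 then g x else h x) := by
  obtain ⟨-, T, hT, H⟩ := hf
  obtain ⟨hbg, Tg, hTg, Hg⟩ := hg
  obtain ⟨hbh, Th, hTh, Hh⟩ := hh
  refine ⟨(hbg.max hbh).mono fun x => ?_, _,
    hT.add ((hTg.max hTh).add (PolyBdd.const 1)), fun loc o hloc => ?_⟩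
  · split_ifs <;> omega
  obtain ⟨P, hP⟩ := H loc o hloc
  obtain ⟨Pg, hPg⟩ := Hg loc o hloc
  obtain ⟨Ph, hPh⟩ := Hh loc o hloc
  refine ⟨.seq P (.ifZero o Pg Ph), fun x S hS => .seq ((hP x S hS).mono le_rfl ?_)⟩
  rintro S' ⟨h1, h2⟩
  have hS' := hS.of_keeps hloc h2
  by_cases h0 : f x = 0
  · refine .ifZero_of_eq (h1.trans h0) ((hPg x S' hS').mono (le_max_left _ _) ?_)
    rintro S'' ⟨h3, h4⟩
    exact ⟨by simp [h0, h3], h2.trans h4 le_rfl⟩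
  · refine .ifZero_of_ne (by rwa [h1]) ((hPh x S' hS').mono (le_max_right _ _) ?_)
    rintro S'' ⟨h3, h4⟩
    exact ⟨by simp [h0, h3], h2.trans h4 le_rfl⟩

/-- This is limited recursion: the bound `b` on all intermediate values keeps the loop body
polynomial. Register `o` holds the accumulator, `o + 1` the index, `o + 2` the remaining iterations
and `o + 3` the next accumulator. -/
theorem natRec {g : (σ × ℕ) × ℕ → ℕ} (hf : PolyTime f) (hh : PolyTime h) (hg : PolyTime g)
    (hb : PolyBdd b)
    (hle : ∀ x, ∀ i ≤ f x, Nat.rec (h x) (fun j acc => g ((x, j), acc)) i ≤ b x) :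
    PolyTime (fun x => (Nat.rec (h x) (fun j acc => g ((x, j), acc)) (f x) : ℕ)) := by
  set R : σ → ℕ → ℕ := fun x i => Nat.rec (h x) (fun j acc => g ((x, j), acc)) i
  have hR0 : ∀ x, R x 0 = h x := fun x => rfl
  obtain ⟨hbf, Tf, hTf, Hf⟩ := hf
  obtain ⟨-, Th, hTh, Hh⟩ := hh
  obtain ⟨-, Tg, hTg, Hg⟩ := hg
  -- The time of one step is made uniform in the accumulator, then in the index.
  obtain ⟨G1, hG1, h1⟩ := hTg.exists_uniform hb.fst
  obtain ⟨B, hB, h2⟩ := hG1.exists_uniform hbf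
  refine ⟨hb.mono fun x => hle x _ le_rfl, _, hTh.add (hTf.add ((PolyBdd.const 1).add
    ((PolyBdd.const 1).add ((hbf.mul ((hB.add (PolyBdd.const 3)).add (PolyBdd.const 1))).add
      (PolyBdd.const 1))))), fun loc o hloc => ?_⟩
  obtain ⟨Ph, hPh⟩ := Hh loc o hloc
  have hloc1 : ∀ i < Ctx.dim σ, loc i < o + 1 := fun i hi => (hloc i hi).trans (Nat.lt_succ_self o)
  obtain ⟨Pf, hPf⟩ := Hf loc (o + 1) hloc1
  obtain ⟨Pg, hPg⟩ := Hg (extend (σ × ℕ) (extend σ loc (o + 1)) o) (o + 3)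
    (extend_lt (extend_lt (fun i hi => (hloc i hi).trans (by omega)) (by omega)) (by omega))
  refine ⟨.seq Ph (.seq Pf (.seq (.copy (o + 2) (o + 1)) (.seq (.const (o + 1) 0)
    (.whileNonzero (o + 2) (.seq Pg (.seq (.copy o (o + 3)) (.seq (.succ (o + 1))
      (.pred (o + 2))))))))), fun x S hS => .seq ((hPh x S hS).mono le_rfl ?_)⟩
  rintro S1 ⟨r1, k1⟩
  refine .seq ((hPf x S1 (hS.of_keeps hloc k1)).mono le_rfl ?_)
  rintro S2 ⟨r2, k2⟩
  refine .seq (.of_exec (.copy _ _ _) (.seq (.of_exec (.const _ _ _) ?_)))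
  set S4 := (S2.set (o + 2) (S2.reg (o + 1))).set (o + 1) 0 with hS4
  have k4 : Keeps o S S4 := (k1.trans k2 (by omega)).trans
    ((Keeps.set (o := o) _ (by omega) _).trans (Keeps.set _ (by omega) _) le_rfl) le_rfl
  have r4 : S4.reg o = h x := by
    rw [hS4, reg_set_of_ne _ (by omega), reg_set_of_ne _ (by omega), k2.1 o (by omega), r1]
  refine (Runs.whileNonzero (B := B x + 3) (fun k S' => k ≤ f x ∧ Keeps o S S' ∧
    S'.reg o = R x (f x - k) ∧ S'.reg (o + 1) = f x - k ∧ S'.reg (o + 2) = k) ?_ ?_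
    (f x) ?_).mono le_rfl ?_
  · rintro k S5 ⟨hk, k5, ra, ri, rk⟩
    refine ⟨by omega, ?_⟩
    have hH := ((hS.of_keeps hloc k5).extend ri).extend ra
    have := hle x (f x - (k + 1)) (by omega)
    refine (Runs.seq (T' := 3) ((hPg _ S5 hH).mono ?_ ?_))
    · exact (h1 _ _ this).trans (h2 _ _ (by omega))
    rintro S6 ⟨r6, k6⟩
    refine .seq (T := 1) (T' := 2) (.of_exec (.copy _ _ _)
      (.seq (T := 1) (T' := 1) (.of_exec (.succ _ _)
      (.of_exec (.pred _ _) ⟨by omega, ?_, ?_, ?_, ?_⟩))))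
    · exact (k5.trans k6 (by omega)).trans ((Keeps.set (o := o) _ le_rfl _).trans
        ((Keeps.set (o := o) _ (by omega) _).trans (Keeps.set _ (by omega) _) le_rfl) le_rfl) le_rfl
    · rw [reg_set_of_ne _ (by omega), reg_set_of_ne _ (by omega), reg_set_self, r6,
        show f x - k = f x - (k + 1) + 1 by omega]
    · rw [reg_set_of_ne _ (by omega), reg_set_self, reg_set_of_ne _ (by omega),
        k6.1 _ (by omega), ri]
      omega
    · rw [reg_set_self, reg_set_of_ne _ (by omega), reg_set_of_ne _ (by omega),
        k6.1 _ (by omega), rk]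
      omega
  · rintro S5 ⟨-, -, -, -, rk⟩
    exact rk
  · refine ⟨le_rfl, k4, by rw [r4, Nat.sub_self, hR0], ?_, ?_⟩
    · rw [hS4, reg_set_self, Nat.sub_self]
    · rw [hS4, reg_set_of_ne _ (by omega), reg_set_self, r2]
  · rintro S5 ⟨-, k5, ra, -⟩
    exact ⟨ra, k5⟩

end PolyTime

/-! ### Change of context. -/

section Rename

variable {τ : Type*} [Ctx τ]

/-- The registers that present `φ y` are among those that present `y`. -/
def Renaming (φ : τ → σ) : Prop :=
  ∃ ρ : ℕ → ℕ, ∀ i < Ctx.dim σ, ρ i < Ctx.dim τ ∧ ∀ y, Ctx.val (φ y) i = Ctx.val y (ρ i)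

namespace Renaming

variable {φ : τ → σ}

theorem refl : Renaming (fun x : σ => x) := ⟨fun i => i, fun _ hi => ⟨hi, fun _ => rfl⟩⟩

theorem fst (h : Renaming φ) : Renaming (fun y : τ × ℕ => φ y.1) := by
  obtain ⟨ρ, hρ⟩ := h
  refine ⟨ρ, fun i hi => ⟨Nat.lt_succ_of_lt (hρ i hi).1, fun y => ?_⟩⟩
  rw [(hρ i hi).2]
  simp [Ctx.val, (hρ i hi).1]

theorem prodMap (h : Renaming φ) : Renaming (fun y : τ × ℕ => (φ y.1, y.2)) := by
  obtain ⟨ρ, hρ⟩ := h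
  refine ⟨fun i => if i < Ctx.dim σ then ρ i else Ctx.dim τ, fun i hi => ?_⟩
  by_cases h : i < Ctx.dim σ
  · simp only [h, if_true]
    refine ⟨Nat.lt_succ_of_lt (hρ i h).1, fun y => ?_⟩
    simp [Ctx.val, h, (hρ i h).1, (hρ i h).2]
  · simp only [h, if_false]
    exact ⟨Nat.lt_succ_self _, fun y => by simp [Ctx.val, h]⟩

theorem height_le (h : Renaming φ) (y : τ) : height (φ y) ≤ height y := by
  obtain ⟨ρ, hρ⟩ := h
  refine Finset.sup_le fun i hi => ?_
  obtain ⟨h1, h2⟩ := hρ i (Finset.mem_range.1 hi)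
  rw [h2]
  exact val_le_height y h1

theorem polyBdd (h : Renaming φ) {f : σ → ℕ} (hf : PolyBdd f) : PolyBdd (fun y => f (φ y)) := by
  obtain ⟨c, hc⟩ := hf
  exact ⟨c, fun y => (hc _).trans
    (Nat.pow_le_pow_left (Nat.add_le_add_right (h.height_le y) 2) c)⟩

end Renaming

namespace PolyTime

variable {φ : τ → σ}

/-- Only addresses change: the program for `f` reads at the locations `loc (ρ i)`, and nothing is
copied. -/
theorem rename {f : σ → ℕ} (hf : PolyTime f) (h : Renaming φ) : PolyTime (fun y => f (φ y)) := by
  obtain ⟨hb, T, hT, H⟩ := hf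
  refine ⟨h.polyBdd hb, _, h.polyBdd hT, fun loc o hloc => ?_⟩
  obtain ⟨ρ, hρ⟩ := h
  obtain ⟨P, hP⟩ := H (fun i => loc (ρ i)) o fun i hi => hloc _ (hρ i hi).1
  refine ⟨P, fun y S hS => hP (φ y) S fun i hi => ?_⟩
  rw [(hρ i hi).2]
  exact hS _ (hρ i hi).1

theorem comp₁ {g : σ → ℕ → ℕ} {f : τ → ℕ} (hg : PolyTime fun x : σ × ℕ => g x.1 x.2)
    (h : Renaming φ) (hf : PolyTime f) : PolyTime (fun y => g (φ y) (f y)) :=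
  hf.letIn (hg.rename h.prodMap)

theorem comp₂ {g : σ → ℕ → ℕ → ℕ} {f f' : τ → ℕ}
    (hg : PolyTime fun x : (σ × ℕ) × ℕ => g x.1.1 x.1.2 x.2)
    (h : Renaming φ) (hf : PolyTime f) (hf' : PolyTime f') :
    PolyTime (fun y => g (φ y) (f y) (f' y)) :=
  hf.letIn (g := fun z => g (φ z.1) z.2 (f' z.1))
    (hf'.fst.letIn (g := fun z => g (φ z.1.1) z.1.2 z.2) (hg.rename h.prodMap.prodMap))

end PolyTime

end Rename

/-! ### Printing lists -/

/-- `P` appends `f x` to the output, in time `T`, and leaves the registers below `o` unchanged. -/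
def PrintsIn (P : Program) (f : σ → List ℕ) (T : σ → ℕ) (loc : ℕ → ℕ) (o : ℕ) : Prop :=
  ∀ (x : σ) (S : State), Holds x loc S → Runs P S (T x) fun S' =>
    (∀ r < o, S'.reg r = S.reg r) ∧ S'.output = S.output ++ f x

/-- The list `f x` can be printed in polynomial time. -/
def PolyPrint (f : σ → List ℕ) : Prop :=
  ∃ T : σ → ℕ, PolyBdd T ∧ ∀ (loc : ℕ → ℕ) (o : ℕ), (∀ i < Ctx.dim σ, loc i < o) →
    ∃ P, PrintsIn P f T loc o

namespace PolyPrint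

variable {f : σ → ℕ} {l l' : σ → List ℕ}

theorem singleton (hf : PolyTime f) : PolyPrint (fun x => [f x]) := by
  obtain ⟨-, T, hT, H⟩ := hf
  refine ⟨_, hT.add (PolyBdd.const 1), fun loc o hloc => ?_⟩
  obtain ⟨P, hP⟩ := H loc o hloc
  refine ⟨.seq P (.print o), fun x S hS => .seq ((hP x S hS).mono le_rfl ?_)⟩
  rintro S' ⟨h1, h2⟩
  exact .of_exec (.print _ _) ⟨h2.1, by rw [h1, h2.2.2]⟩

theorem append (hl : PolyPrint l) (hl' : PolyPrint l') : PolyPrint (fun x => l x ++ l' x) := by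
  obtain ⟨T, hT, H⟩ := hl
  obtain ⟨T', hT', H'⟩ := hl'
  refine ⟨_, hT.add hT', fun loc o hloc => ?_⟩
  obtain ⟨P, hP⟩ := H loc o hloc
  obtain ⟨P', hP'⟩ := H' loc o hloc
  refine ⟨.seq P P', fun x S hS => .seq ((hP x S hS).mono le_rfl ?_)⟩
  rintro S' ⟨h1, h2⟩
  refine (hP' x S' fun i hi => (h1 _ (hloc i hi)).trans (hS i hi)).mono le_rfl ?_
  rintro S'' ⟨h3, h4⟩
  exact ⟨fun r hr => (h3 r hr).trans (h1 r hr), by rw [h4, h2, List.append_assoc]⟩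

theorem flatMap_range {g : σ → ℕ → List ℕ} (hf : PolyTime f)
    (hg : PolyPrint fun y : σ × ℕ => g y.1 y.2) :
    PolyPrint (fun x => (List.range (f x)).flatMap (g x)) := by
  obtain ⟨hbf, Tf, hTf, Hf⟩ := hf
  obtain ⟨Tg, hTg, Hg⟩ := hg
  obtain ⟨B, hB, h2⟩ := hTg.exists_uniform hbf
  refine ⟨_, hTf.add ((PolyBdd.const 1).add ((PolyBdd.const 1).add ((hbf.mul
    ((hB.add (PolyBdd.const 2)).add (PolyBdd.const 1))).add (PolyBdd.const 1)))),
    fun loc o hloc => ?_⟩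
  obtain ⟨Pf, hPf⟩ := Hf loc o hloc
  obtain ⟨Pg, hPg⟩ := Hg (extend σ loc o) (o + 2)
    (extend_lt (fun i hi => (hloc i hi).trans (by omega)) (by omega))
  refine ⟨.seq Pf (.seq (.copy (o + 1) o) (.seq (.const o 0)
    (.whileNonzero (o + 1) (.seq Pg (.seq (.succ o) (.pred (o + 1))))))),
      fun x S hS => .seq ((hPf x S hS).mono le_rfl ?_)⟩
  rintro S2 ⟨r2, k2⟩
  refine .seq (.of_exec (.copy _ _ _) (.seq (.of_exec (.const _ _ _) ?_)))
  set S4 := (S2.set (o + 1) (S2.reg o)).set o 0 with hS4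
  have k4 : Keeps o S S4 := k2.trans
    ((Keeps.set (o := o) _ (by omega) _).trans (Keeps.set _ (by omega) _) le_rfl) le_rfl
  refine (Runs.whileNonzero (B := B x + 2) (fun k S' => k ≤ f x ∧ (∀ r < o, S'.reg r = S.reg r) ∧
    S'.output = S.output ++ (List.range (f x - k)).flatMap (g x) ∧
    S'.reg o = f x - k ∧ S'.reg (o + 1) = k) ?_ ?_ (f x) ?_).mono le_rfl ?_
  · rintro k S5 ⟨hk, k5, ra, ri, rk⟩
    refine ⟨by omega, ?_⟩
    have hH := Holds.extend (x := x) (fun i hi => (k5 _ (hloc i hi)).trans (hS i hi)) ri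
    refine (Runs.seq (T' := 2) ((hPg _ S5 hH).mono (h2 _ _ (by omega)) ?_))
    rintro S6 ⟨k6, r6⟩
    refine .seq (T := 1) (T' := 1) (.of_exec (.succ _ _)
      (.of_exec (.pred _ _) ⟨by omega, fun r hr => ?_, ?_, ?_, ?_⟩))
    · rw [reg_set_of_ne _ (by omega), reg_set_of_ne _ (by omega), k6 _ (by omega), k5 r hr]
    · change S6.output = _
      rw [r6, ra, show f x - k = f x - (k + 1) + 1 by omega, List.range_succ, List.flatMap_append]
      simp
    · rw [reg_set_of_ne _ (by omega), reg_set_self, k6 _ (by omega), ri]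
      omega
    · rw [reg_set_self, reg_set_of_ne _ (by omega), k6 _ (by omega), rk]
      omega
  · rintro S5 ⟨-, -, -, -, rk⟩
    exact rk
  · refine ⟨le_rfl, k4.1, ?_, ?_, ?_⟩
    · rw [k4.2.2]
      simp
    · rw [hS4, reg_set_self, Nat.sub_self]
    · rw [hS4, reg_set_of_ne _ (by omega), reg_set_self, r2]
  · rintro S5 ⟨-, k5, ra, -⟩
    exact ⟨k5, by simpa using ra⟩

end PolyPrint

end Computable

end RAM

namespace RAM

open OCA (bit)

theorem bit_of_pos {p : Prop} (h : p) : bit p = 1 := by simp [bit, h]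

theorem bit_of_neg {p : Prop} (h : ¬ p) : bit p = 0 := by simp [bit, h]

theorem bit_eq_zero {p : Prop} : bit p = 0 ↔ ¬ p := by by_cases h : p <;> simp [bit, h]

theorem bit_le_one (p : Prop) : bit p ≤ 1 := by by_cases h : p <;> simp [bit, h]

/-! ### Polynomial-time arithmetic, bounded quantifiers and bounded search. -/

section Library

variable {σ : Type*} [Ctx σ]

namespace PolyTime

variable {f g h b : σ → ℕ}

theorem of_eq (hf : PolyTime f) (h : ∀ x, f x = g x) : PolyTime g := funext h ▸ hf

theorem rec_nat {g : σ → ℕ → ℕ → ℕ} (hf : PolyTime f) (hh : PolyTime h)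
    (hg : PolyTime fun y : (σ × ℕ) × ℕ => g y.1.1 y.1.2 y.2) (hb : PolyBdd b)
    (hle : ∀ x, ∀ i ≤ f x, Nat.rec (h x) (g x) i ≤ b x) :
    PolyTime (fun x => (Nat.rec (h x) (g x) (f x) : ℕ)) :=
  natRec (g := fun y => g y.1.1 y.1.2 y.2) hf hh hg hb hle

theorem add (hf : PolyTime f) (hg : PolyTime g) : PolyTime (fun x => f x + g x) := by
  have key : ∀ a n, Nat.rec (motive := fun _ => ℕ) a (fun _ acc => acc + 1) n = a + n :=
      fun a n => by
    induction n with
    | zero => rfl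
    | succ n ih => exact congrArg (· + 1) ih
  refine (rec_nat (g := fun _ _ acc => acc + 1) hg hf snd.succ (hf.1.add hg.1)
    fun x i hi => ?_).of_eq fun x => key _ _
  rw [key]
  omega

theorem sub (hf : PolyTime f) (hg : PolyTime g) : PolyTime (fun x => f x - g x) := by
  have key : ∀ a n, Nat.rec (motive := fun _ => ℕ) a (fun _ acc => acc - 1) n = a - n :=
      fun a n => by
    induction n with
    | zero => rfl
    | succ n ih => exact congrArg (· - 1) ih
  refine (rec_nat (g := fun _ _ acc => acc - 1) hg hf snd.pred hf.1
    fun x i hi => ?_).of_eq fun x => key _ _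
  rw [key]
  omega

theorem sum_range {g : σ → ℕ → ℕ} (hf : PolyTime f)
    (hg : PolyTime fun y : σ × ℕ => g y.1 y.2) :
    PolyTime (fun x => ∑ i ∈ Finset.range (f x), g x i) := by
  have key : ∀ x n, Nat.rec (motive := fun _ => ℕ) 0 (fun i acc => acc + g x i) n =
      ∑ i ∈ Finset.range n, g x i := fun x n => by
    induction n with
    | zero => rfl
    | succ n ih => rw [Finset.sum_range_succ, ← ih]
  obtain ⟨G, hG, hle⟩ := hg.1.exists_uniform hf.1
  refine (rec_nat (g := fun x i acc => acc + g x i) hf (const 0) (snd.add hg.fst) (hf.1.mul hG)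
    fun x i hi => ?_).of_eq fun x => key _ _
  rw [key]
  calc _ ≤ ∑ _j ∈ Finset.range i, G x := Finset.sum_le_sum fun j hj => by
        have := Finset.mem_range.1 hj
        exact hle x j (by omega)
    _ = i * G x := by simp
    _ ≤ _ := Nat.mul_le_mul_right _ hi

theorem mul (hf : PolyTime f) (hg : PolyTime g) : PolyTime (fun x => f x * g x) :=
  (sum_range hf (g := fun x _ => g x) hg.fst).of_eq fun x => by simp

/-- A bound has to be supplied, since `2 ^ f x` need not be polynomial in the numbers that present
`x`. -/
theorem two_pow (hf : PolyTime f) (hb : PolyBdd b) (hle : ∀ x, 2 ^ f x ≤ b x) :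
    PolyTime (fun x => 2 ^ f x) := by
  have key : ∀ n, Nat.rec (motive := fun _ => ℕ) 1 (fun _ acc => acc + acc) n = 2 ^ n := fun n => by
    induction n with
    | zero => rfl
    | succ n ih => rw [pow_succ, mul_two, ← ih]
  refine (rec_nat (g := fun _ _ acc => acc + acc) hf (const 1) (snd.add snd) hb
    fun x i hi => ?_).of_eq fun x => key _
  rw [key]
  exact (Nat.pow_le_pow_right (by omega) hi).trans (hle x)

end PolyTime

/-- The predicate `p` is decidable in polynomial time, where the numbers in the argument count
with their values. -/
def PolyDec (p : σ → Prop) : Prop := PolyTime (fun x => bit (p x))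

theorem PolyTime.ite {p : σ → Prop} {f g : σ → ℕ} [DecidablePred p] (hp : PolyDec p)
    (hf : PolyTime f) (hg : PolyTime g) : PolyTime (fun x => if p x then f x else g x) :=
  (PolyTime.ifZero hp hg hf).of_eq fun x => by by_cases h : p x <;> simp [bit, h]

namespace PolyDec

variable {p q : σ → Prop} {f g : σ → ℕ}

theorem of_iff (hp : PolyDec p) (h : ∀ x, p x ↔ q x) : PolyDec q :=
  PolyTime.of_eq hp fun x => by rw [h x]

theorem fst (hp : PolyDec p) : PolyDec (fun x : σ × ℕ => p x.1) := PolyTime.fst hp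

section Rename

variable {τ : Type*} [Ctx τ] {φ : τ → σ}

theorem comp₁ {p : σ → ℕ → Prop} {f : τ → ℕ} (hp : PolyDec fun x : σ × ℕ => p x.1 x.2)
    (h : Renaming φ) (hf : PolyTime f) : PolyDec (fun y => p (φ y) (f y)) :=
  PolyTime.comp₁ (g := fun x v => bit (p x v)) hp h hf

theorem comp₂ {p : σ → ℕ → ℕ → Prop} {f f' : τ → ℕ}
    (hp : PolyDec fun x : (σ × ℕ) × ℕ => p x.1.1 x.1.2 x.2)
    (h : Renaming φ) (hf : PolyTime f) (hf' : PolyTime f') :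
    PolyDec (fun y => p (φ y) (f y) (f' y)) :=
  PolyTime.comp₂ (g := fun x v w => bit (p x v w)) hp h hf hf'

end Rename

theorem eq_zero (hf : PolyTime f) : PolyDec (fun x => f x = 0) :=
  (PolyTime.ifZero hf (.const 1) (.const 0)).of_eq fun _ => by simp [bit]

theorem not (hp : PolyDec p) : PolyDec (fun x => ¬ p x) :=
  (eq_zero hp).of_iff fun _ => bit_eq_zero

theorem and (hp : PolyDec p) (hq : PolyDec q) : PolyDec (fun x => p x ∧ q x) :=
  (PolyTime.mul hp hq).of_eq fun x => by
    by_cases h : p x <;> by_cases h' : q x <;> simp [bit, h, h']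

theorem or (hp : PolyDec p) (hq : PolyDec q) : PolyDec (fun x => p x ∨ q x) :=
  (hp.not.and hq.not).not.of_iff fun x => by tauto

theorem imp (hp : PolyDec p) (hq : PolyDec q) : PolyDec (fun x => p x → q x) :=
  (hp.not.or hq).of_iff fun x => by tauto

theorem le (hf : PolyTime f) (hg : PolyTime g) : PolyDec (fun x => f x ≤ g x) :=
  (eq_zero (hf.sub hg)).of_iff fun x => by omega

theorem lt (hf : PolyTime f) (hg : PolyTime g) : PolyDec (fun x => f x < g x) :=
  le hf.succ hg

theorem eq (hf : PolyTime f) (hg : PolyTime g) : PolyDec (fun x => f x = g x) :=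
  ((le hf hg).and (le hg hf)).of_iff fun x => by omega

/-- The truth bits are summed over the whole range. This is polynomial because numbers count with
their values and not with their lengths. -/
theorem exists_lt {p : σ → ℕ → Prop} (hf : PolyTime f)
    (hp : PolyDec fun y : σ × ℕ => p y.1 y.2) : PolyDec (fun x => ∃ i < f x, p x i) :=
  (eq_zero (PolyTime.sum_range (g := fun x i => bit (p x i)) hf hp)).not.of_iff fun x => by
    simp [bit_eq_zero]

theorem forall_lt {p : σ → ℕ → Prop} (hf : PolyTime f)
    (hp : PolyDec fun y : σ × ℕ => p y.1 y.2) : PolyDec (fun x => ∀ i < f x, p x i) :=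
  (exists_lt (p := fun x i => ¬ p x i) hf hp.not).not.of_iff fun x => by simp

theorem exists_le {p : σ → ℕ → Prop} (hf : PolyTime f)
    (hp : PolyDec fun y : σ × ℕ => p y.1 y.2) : PolyDec (fun x => ∃ i ≤ f x, p x i) :=
  (exists_lt hf.succ hp).of_iff fun x => by simp

theorem forall_le {p : σ → ℕ → Prop} (hf : PolyTime f)
    (hp : PolyDec fun y : σ × ℕ => p y.1 y.2) : PolyDec (fun x => ∀ i ≤ f x, p x i) :=
  (forall_lt hf.succ hp).of_iff fun x => by simp

end PolyDec

namespace PolyTime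

variable {f g b : σ → ℕ}

theorem findGreatest {p : σ → ℕ → Prop} [∀ x, DecidablePred (p x)] (hf : PolyTime f)
    (hp : PolyDec fun y : σ × ℕ => p y.1 y.2) :
    PolyTime (fun x => Nat.findGreatest (p x) (f x)) := by
  have key : ∀ x n, Nat.rec (motive := fun _ => ℕ) 0
      (fun i acc => if p x (i + 1) then i + 1 else acc) n = Nat.findGreatest (p x) n :=
      fun x n => by
    induction n with
    | zero => rfl
    | succ n ih => rw [Nat.findGreatest_succ, ← ih]
  have hp' : PolyDec fun y : σ × ℕ => p y.1 (y.2 + 1) := hp.comp₁ Renaming.refl.fst snd.succ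
  refine (rec_nat (g := fun x i acc => if p x (i + 1) then i + 1 else acc) hf (const 0)
    (ite hp'.fst (snd (σ := σ)).succ.fst snd) hf.1 fun x i hi => ?_).of_eq fun x => key _ _
  rw [key]
  exact (Nat.findGreatest_le _).trans hi

theorem div (hf : PolyTime f) (hg : PolyTime g) : PolyTime (fun x => f x / g x) := by
  have h := findGreatest (p := fun x i => i * g x ≤ f x) hf
    (.le (mul snd hg.fst) hf.fst)
  refine (ifZero hg (const 0) h).of_eq fun x => ?_
  split_ifs with h0
  · rw [h0, Nat.div_zero]
  · have hpos : 0 < g x := Nat.pos_of_ne_zero h0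
    refine le_antisymm ((Nat.le_div_iff_mul_le hpos).2 ?_) ?_
    · exact Nat.findGreatest_spec (P := fun i => i * g x ≤ f x) (m := 0) (Nat.zero_le _) (by simp)
    · exact Nat.le_findGreatest (Nat.div_le_self _ _) (Nat.div_mul_le_self _ _)

theorem mod (hf : PolyTime f) (hg : PolyTime g) : PolyTime (fun x => f x % g x) :=
  (hf.sub (hg.mul (hf.div hg))).of_eq fun x => by
    have := Nat.mod_add_div (f x) (g x)
    omega

protected theorem min (hf : PolyTime f) (hg : PolyTime g) : PolyTime (fun x => min (f x) (g x)) :=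
  (ite (.le hf hg) hf hg).of_eq fun x => by split_ifs <;> omega

end PolyTime

theorem PolyDec.testBit {f g : σ → ℕ} (hf : PolyTime f) (hg : PolyTime g) :
    PolyDec (fun x => (f x).testBit (g x) = true) := by
  have key : ∀ a n, Nat.rec (motive := fun _ => ℕ) a (fun _ acc => acc / 2) n = a / 2 ^ n :=
    fun a n => by
      induction n with
      | zero => simp
      | succ n ih => rw [pow_succ, ← Nat.div_div_eq_div_mul, ← ih]
  have h := PolyTime.rec_nat (g := fun _ _ acc => acc / 2) hg hf
    (PolyTime.snd.div (.const 2)) hf.1 fun x i hi => by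
      rw [key]
      exact Nat.div_le_self _ _
  refine (PolyDec.eq (h.mod (.const 2)) (.const 1)).of_iff fun x => ?_
  rw [key, Nat.testBit_eq_decide_div_mod_eq, decide_eq_true_iff]

end Library

end RAM

/-! ### Sets of numbers as bits of a number -/

/-- The number whose bits below `K` are the truth values of `p`. -/
noncomputable def bitCode (K : ℕ) (p : ℕ → Prop) : ℕ := ∑ i ∈ Finset.range K, OCA.bit (p i) * 2 ^ i

theorem bitCode_succ (K : ℕ) (p : ℕ → Prop) :
    bitCode (K + 1) p = bitCode K p + OCA.bit (p K) * 2 ^ K := Finset.sum_range_succ _ _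

theorem bitCode_lt (K : ℕ) (p : ℕ → Prop) : bitCode K p < 2 ^ K := by
  induction K with
  | zero => simp [bitCode]
  | succ K ih =>
    have := Nat.mul_le_mul_right (2 ^ K) (RAM.bit_le_one (p K))
    rw [bitCode_succ, pow_succ]
    omega

theorem testBit_bitCode (K : ℕ) (p : ℕ → Prop) (i : ℕ) :
    (bitCode K p).testBit i = true ↔ i < K ∧ p i := by
  induction K with
  | zero => simp [bitCode]
  | succ K ih =>
    have hlt := bitCode_lt K p
    have e : bitCode (K + 1) p = 2 ^ K * OCA.bit (p K) + bitCode K p := by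
      rw [bitCode_succ]; ring
    rw [e, Nat.testBit_two_pow_mul_add _ hlt]
    split_ifs with h
    · rw [ih]
      exact and_congr_left fun _ => ⟨fun h => by omega, fun _ => h⟩
    · by_cases hp : p K
      · rw [RAM.bit_of_pos hp, Nat.testBit_one_eq_true_iff_self_eq_zero]
        constructor
        · intro h'
          obtain rfl : i = K := by omega
          exact ⟨by omega, hp⟩
        · omega
      · rw [RAM.bit_of_neg hp, Nat.zero_testBit]
        constructor
        · simp
        · rintro ⟨h1, h2⟩
          obtain rfl : i = K := by omega
          exact absurd h2 hp

theorem RAM.PolyTime.bitCode {σ : Type*} [RAM.Ctx σ] {K b : σ → ℕ} {p : σ → ℕ → Prop}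
    (hK : RAM.PolyTime K) (hp : RAM.PolyDec fun y : σ × ℕ => p y.1 y.2) (hb : RAM.PolyBdd b)
    (hle : ∀ x, 2 ^ K x ≤ b x) : RAM.PolyTime (fun x => bitCode (K x) (p x)) := by
  -- The exponent is capped because `sum_range` wants a polynomially bounded summand at every index,
  -- also outside the range; inside it the cap has no effect.
  have h2 : RAM.PolyTime (fun y : σ × ℕ => 2 ^ min y.2 (K y.1)) :=
    .two_pow (RAM.PolyTime.snd.min hK.fst) hb.fst fun y =>
      (Nat.pow_le_pow_right (by omega) (min_le_right _ _)).trans (hle y.1)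
  refine (RAM.PolyTime.sum_range (g := fun x i => OCA.bit (p x i) * 2 ^ min i (K x)) hK
    (RAM.PolyTime.mul hp h2)).of_eq fun x => Finset.sum_congr rfl fun i hi => ?_
  rw [min_eq_left (Finset.mem_range.1 hi).le]

/-! ### Silent paths of a counter system -/

namespace Silent

open Relation

variable {Q : Type*} (I D : ℕ → Q → Q → Prop)

/-- One increment or decrement; `I x` and `D x` are the possible changes of state at the counter
value `x`. -/
inductive Move : Q × ℕ → Q × ℕ → Prop
  | inc {x : ℕ} {a b : Q} (h : I x a b) : Move (a, x) (b, x + 1)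
  | dec {x : ℕ} {a b : Q} (h : D (x + 1) a b) : Move (a, x + 1) (b, x)

/-- Paths of increments and decrements. -/
def Path : Q × ℕ → Q × ℕ → Prop := ReflTransGen (Move I D)

/-- An excursion below `x + 1`, given the relation `R` of the excursions that stay below `x`. -/
def Dip (x : ℕ) (R : Q → Q → Prop) (a b : Q) : Prop := ∃ u v, D (x + 1) a u ∧ R u v ∧ I x v b

/-- The paths from level `x` to level `x` that stay at levels at most `x`. -/
def Down : ℕ → Q → Q → Prop
  | 0 => Eq
  | x + 1 => ReflTransGen (Dip I D x (Down x))

/-- The paths from level `x` to level `x` that visit `x` only at the ends and are below `x`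
otherwise. -/
def DownStep : ℕ → Q → Q → Prop
  | 0 => fun _ _ => False
  | x + 1 => Dip I D x (Down I D x)

/-- The paths from level `x` to level `x` that stay at levels at least `x`. -/
inductive Up : ℕ → Q → Q → Prop
  | refl (x : ℕ) (a : Q) : Up x a a
  | step {x : ℕ} {a u v b c : Q} (h₁ : I x a u) (h₂ : Up (x + 1) u v) (h₃ : D (x + 1) v b)
      (h₄ : Up x b c) : Up x a c

/-- The paths from level `x` to level `x` that visit `x` only at the ends and are above `x`
otherwise. -/
def UpStep (x : ℕ) (a b : Q) : Prop := ∃ u v, I x a u ∧ Up I D (x + 1) u v ∧ D (x + 1) v b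

/-- The paths from level `x` to level `x`, described by excursions. -/
def Flat (x : ℕ) : Q → Q → Prop :=
  ReflTransGen fun a b => DownStep I D x a b ∨ UpStep I D x a b

variable {I D}

theorem down_iff {x : ℕ} {a b : Q} : Down I D x a b ↔ ReflTransGen (DownStep I D x) a b := by
  cases x with
  | zero =>
    refine ⟨fun h => by obtain rfl : a = b := h; exact .refl, fun h => ?_⟩
    induction h with
    | refl => rfl
    | tail _ h _ => exact h.elim
  | succ x => rfl

theorem up_iff {x : ℕ} {a b : Q} : Up I D x a b ↔ ReflTransGen (UpStep I D x) a b := by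
  constructor
  · intro h
    induction h with
    | refl => exact .refl
    | step h₁ h₂ h₃ _ _ ih => exact .head ⟨_, _, h₁, h₂, h₃⟩ ih
  · intro h
    induction h using ReflTransGen.head_induction_on with
    | refl => exact .refl _ _
    | head h _ ih =>
      obtain ⟨u, v, h₁, h₂, h₃⟩ := h
      exact .step h₁ h₂ h₃ ih

theorem Down.path {x : ℕ} {a b : Q} (h : Down I D x a b) : Path I D (a, x) (b, x) := by
  induction x generalizing a b with
  | zero => obtain rfl : a = b := h; exact .refl
  | succ x ih =>
    change ReflTransGen _ a b at h
    induction h with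
    | refl => exact .refl
    | tail _ h ihh =>
      obtain ⟨u, v, h₁, h₂, h₃⟩ := h
      exact ihh.trans (.head (.dec h₁) ((ih h₂).tail (.inc h₃)))

theorem Up.path {x : ℕ} {a b : Q} (h : Up I D x a b) : Path I D (a, x) (b, x) := by
  induction h with
  | refl => exact .refl
  | step h₁ _ h₃ _ ih ih' => exact .head (.inc h₁) (ih.trans (.head (.dec h₃) ih'))

theorem Flat.path {x : ℕ} {a b : Q} (h : Flat I D x a b) : Path I D (a, x) (b, x) := by
  change ReflTransGen _ a b at h
  induction h with
  | refl => exact .refl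
  | tail _ h ih =>
    refine ih.trans ?_
    obtain h | ⟨u, v, h₁, h₂, h₃⟩ := h
    · cases x with
      | zero => exact h.elim
      | succ x =>
        obtain ⟨u, v, h₁, h₂, h₃⟩ := h
        exact .head (.dec h₁) (h₂.path.tail (.inc h₃))
    · exact .head (.inc h₁) (h₂.path.tail (.dec h₃))

/-- A path from level `x` to `(b, y)`, decomposed at the first visits to the levels between. -/
inductive Passage (I D : ℕ → Q → Q → Prop) (b : Q) (y : ℕ) : ℕ → Q → Prop
  | flat {a : Q} (h : Flat I D y a b) : Passage I D b y y a
  | descend {x : ℕ} {a u v : Q} (hx : y ≤ x) (h₁ : Up I D (x + 1) a u) (h₂ : D (x + 1) u v)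
      (h₃ : Passage I D b y x v) : Passage I D b y (x + 1) a
  | ascend {x : ℕ} {a u v : Q} (hx : x < y) (h₁ : Down I D x a u) (h₂ : I x u v)
      (h₃ : Passage I D b y (x + 1) v) : Passage I D b y x a

/-- The excursion is absorbed by the first segment of the passage; an ascent is excluded by `hx`. -/
theorem Passage.of_upStep {b : Q} {x y : ℕ} (hx : y ≤ x) {a a' : Q} (h : UpStep I D x a a')
    (hp : Passage I D b y x a') : Passage I D b y x a := by
  cases hp with
  | flat h' => exact .flat (.head (.inr h) h')
  | descend hx' h₁ h₂ h₃ => exact .descend hx' (up_iff.2 (.head h (up_iff.1 h₁))) h₂ h₃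
  | ascend hx' => omega

theorem Passage.of_downStep {b : Q} {x y : ℕ} (hx : x ≤ y) {a a' : Q} (h : DownStep I D x a a')
    (hp : Passage I D b y x a') : Passage I D b y x a := by
  cases hp with
  | flat h' => exact .flat (.head (.inl h) h')
  | descend hx' => omega
  | ascend hx' h₁ h₂ h₃ => exact .ascend hx' (down_iff.2 (.head h (down_iff.1 h₁))) h₂ h₃

/-- Moves are prepended one at a time. A move towards the target level opens a new segment. After a
move away from it, the rest has to cross back; both crossings and the segment between them form an
excursion that `of_upStep` or `of_downStep` absorbs. -/
theorem Passage.of_path {c c' : Q × ℕ} (h : Path I D c c') : Passage I D c'.1 c'.2 c.2 c.1 := by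
  obtain ⟨b, y⟩ := c'
  change ReflTransGen _ c (b, y) at h
  induction h using ReflTransGen.head_induction_on with
  | refl => exact .flat .refl
  | head h _ ih =>
    cases h with
    | @inc x a a' h =>
      dsimp only at ih ⊢
      rcases lt_or_ge x y with hx | hx
      · exact .ascend hx (down_iff.2 .refl) h ih
      · cases ih with
        | flat => omega
        | descend _ h₁ h₂ h₃ => exact h₃.of_upStep hx ⟨_, _, h, h₁, h₂⟩
        | ascend hx' => omega
    | @dec x a a' h =>
      dsimp only at ih ⊢
      rcases lt_or_ge x y with hx | hx
      · cases ih with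
        | flat => omega
        | descend _ h₁ h₂ h₃ => omega
        | ascend hx' h₁ h₂ h₃ => exact h₃.of_downStep hx ⟨_, _, h, h₁, h₂⟩
      · exact .descend hx (.refl _ _) h ih

/-- A passage whose start and target levels coincide can begin neither with a descent nor with an
ascent. -/
theorem path_iff_flat {x : ℕ} {a b : Q} : Path I D (a, x) (b, x) ↔ Flat I D x a b := by
  refine ⟨fun h => ?_, Flat.path⟩
  have := Passage.of_path h
  dsimp only at this
  cases this with
  | flat h => exact h
  | descend h' => omega
  | ascend h' => omega

/-- The split is at the first increment from `y` to `y + 1`: what follows starts and ends at level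
`y + 1`, so it is flat whatever detours it makes. -/
theorem Path.exists_inc {x y : ℕ} {a b : Q} (h : Path I D (a, x) (b, y + 1)) (hx : x ≤ y) :
    ∃ u v, Path I D (a, x) (u, y) ∧ I y u v ∧ Flat I D (y + 1) v b := by
  suffices H : ∀ c, Path I D c (b, y + 1) → c.2 ≤ y →
      ∃ u v, Path I D c (u, y) ∧ I y u v ∧ Flat I D (y + 1) v b from H _ h hx
  clear h
  intro c hc
  change ReflTransGen _ c _ at hc
  induction hc using ReflTransGen.head_induction_on with
  | refl => intro h; simp at h
  | @head c c' h hp ih =>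
    intro hcy
    by_cases hy : c'.2 ≤ y
    · obtain ⟨u, v, h₁, h₂, h₃⟩ := ih hy
      exact ⟨u, v, .head h h₁, h₂, h₃⟩
    · cases h with
      | @inc x a a' h =>
        dsimp only at hcy hy
        obtain rfl : x = y := by omega
        exact ⟨a, a', .refl, h, path_iff_flat.1 hp⟩
      | dec h => dsimp only at hcy hy; omega

theorem Path.exists_dec {x y : ℕ} {a b : Q} (h : Path I D (a, x) (b, y)) (hx : y < x) :
    ∃ u v, Path I D (a, x) (u, y + 1) ∧ D (y + 1) u v ∧ Flat I D y v b := by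
  suffices H : ∀ c, Path I D c (b, y) → y < c.2 →
      ∃ u v, Path I D c (u, y + 1) ∧ D (y + 1) u v ∧ Flat I D y v b from H _ h hx
  clear h
  intro c hc
  change ReflTransGen _ c _ at hc
  induction hc using ReflTransGen.head_induction_on with
  | refl => intro h; simp at h
  | @head c c' h hp ih =>
    intro hcy
    by_cases hy : y < c'.2
    · obtain ⟨u, v, h₁, h₂, h₃⟩ := ih hy
      exact ⟨u, v, .head h h₁, h₂, h₃⟩
    · cases h with
      | inc h => dsimp only at hcy hy; omega
      | @dec x a a' h =>
        dsimp only at hcy hy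
        obtain rfl : x = y := by omega
        exact ⟨a, a', .refl, h, path_iff_flat.1 hp⟩

/-- Above the threshold `m`, the paths that stay at levels at least `x` do not depend on `x`. -/
theorem Up.succ {m x : ℕ} {a b : Q} (hI : ∀ y, m ≤ y → I (y + 1) = I y)
    (hD : ∀ y, m ≤ y → D (y + 1) = D y) (hx : m ≤ x) (h : Up I D x a b) : Up I D (x + 1) a b := by
  induction h with
  | refl => exact .refl _ _
  | step h₁ _ h₃ _ ih ih' =>
    refine .step (by rwa [hI _ hx]) (ih (by omega)) (by rwa [hD _ (by omega)]) (ih' hx)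

end Silent

/-! ### Automata given by numbers -/

/-- The description of a one-counter automaton by numbers: the numbers of states and of letters,
the threshold, the initial state, and a number whose bits are those of the characteristic functions
of the final states and of the transition relation. -/
structure NumOCA where
  n : ℕ
  s : ℕ
  m : ℕ
  q0 : ℕ
  c : ℕ
  n_pos : 0 < n
  s_pos : 0 < s

namespace NumOCA

open RAM Relation

/-- The number of bits of `d.c`. -/
def len (d : NumOCA) : ℕ := d.n + d.n * ((d.m + 1) * ((d.s + 2) * d.n))

/-- `2` to the number of bits. -/
def p (d : NumOCA) : ℕ := 2 ^ d.len

/-- The redundant sixth number `d.p` gives `PolyTime` on this context its meaning: polynomial in `2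
^ d.len`. It is also the bound for every power of two below. -/
instance : Ctx NumOCA where
  dim := 6
  val d
    | 0 => d.n
    | 1 => d.s
    | 2 => d.m
    | 3 => d.q0
    | 4 => d.c
    | _ => d.p

/-- This makes the number of relations on the `d.n + 1` states at most `d.p`. A letter is needed:
for `d.n = 1`, `d.m = 0` and `d.s = 0` there would be three bits only. -/
theorem sq_le_len (d : NumOCA) : (d.n + 1) ^ 2 ≤ d.len := by
  have h := d.n_pos
  have hs := d.s_pos
  have h1 : 1 * (3 * d.n) ≤ (d.m + 1) * ((d.s + 2) * d.n) :=
    Nat.mul_le_mul (by omega) (Nat.mul_le_mul (by omega) le_rfl)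
  have h2 := Nat.mul_le_mul_left d.n h1
  have h3 : 1 * d.n ≤ d.n * d.n := Nat.mul_le_mul h le_rfl
  unfold len
  nlinarith

theorem two_pow_sq_le (d : NumOCA) : 2 ^ (d.n + 1) ^ 2 ≤ d.p :=
  Nat.pow_le_pow_right (by omega) d.sq_le_len

theorem two_pow_le (d : NumOCA) : 2 ^ (d.n + 1) ≤ d.p :=
  (Nat.pow_le_pow_right (by omega) (by nlinarith)).trans d.two_pow_sq_le

/-! #### The transitions, with a new state `d.n` for acceptance -/

/-- The bit of the transition from `q` to `q'` under the counter test `k` with the symbol `j`. -/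
def Trans (d : NumOCA) (k j q q' : ℕ) : Prop :=
  q < d.n ∧ q' < d.n ∧
    d.c.testBit (d.n + (((q * (d.m + 1) + k) * (d.s + 2) + j) * d.n + q')) = true

/-- Increments at the counter value `x`; those from final states may go to the new state. -/
def Inc (d : NumOCA) (x q q' : ℕ) : Prop :=
  d.Trans (min x d.m) d.s q q' ∨ q' = d.n ∧ (q = d.n ∨ q < d.n ∧ d.c.testBit q = true)

/-- Decrements at the counter value `x`. -/
def Dec (d : NumOCA) (x q q' : ℕ) : Prop :=
  d.Trans (min x d.m) (d.s + 1) q q' ∨ q' = d.n ∧ q = d.n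

theorem Inc.le {d : NumOCA} {x q q' : ℕ} (h : d.Inc x q q') : q ≤ d.n ∧ q' ≤ d.n := by
  rcases h with h | h
  · exact ⟨h.1.le, h.2.1.le⟩
  · omega

theorem Dec.le {d : NumOCA} {x q q' : ℕ} (h : d.Dec x q q') : q ≤ d.n ∧ q' ≤ d.n := by
  rcases h with h | h
  · exact ⟨h.1.le, h.2.1.le⟩
  · omega

theorem inc_congr (d : NumOCA) {x y : ℕ} (h : min x d.m = min y d.m) : d.Inc x = d.Inc y := by
  funext q q'
  simp only [Inc, h]

theorem dec_congr (d : NumOCA) {x y : ℕ} (h : min x d.m = min y d.m) : d.Dec x = d.Dec y := by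
  funext q q'
  simp only [Dec, h]

/-! #### Relations on the states as numbers -/

/-- The reflexive transitive closure of `X`, by a quantification over the sets of states. -/
def Closure (d : NumOCA) (X : ℕ → ℕ → Prop) (a b : ℕ) : Prop :=
  ∀ Z < 2 ^ (d.n + 1), Z.testBit a = true →
    (∀ u ≤ d.n, ∀ v ≤ d.n, Z.testBit u = true → X u v → Z.testBit v = true) → Z.testBit b = true

/-- The relation on the states that is coded by the number `R`. -/
def Rel (d : NumOCA) (R a b : ℕ) : Prop := R.testBit (a * (d.n + 1) + b) = true

/-- The code of the restriction of `X` to the states. -/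
noncomputable def relCode (d : NumOCA) (X : ℕ → ℕ → Prop) : ℕ :=
  bitCode ((d.n + 1) ^ 2) fun i => X (i / (d.n + 1)) (i % (d.n + 1))

theorem relCode_lt (d : NumOCA) (X : ℕ → ℕ → Prop) : d.relCode X < 2 ^ (d.n + 1) ^ 2 :=
  bitCode_lt _ _

theorem rel_relCode (d : NumOCA) {X : ℕ → ℕ → Prop} {a b : ℕ} (ha : a ≤ d.n) (hb : b ≤ d.n) :
    d.Rel (d.relCode X) a b ↔ X a b := by
  have h1 : a * (d.n + 1) + b < (d.n + 1) ^ 2 := by nlinarith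
  have h2 : (a * (d.n + 1) + b) / (d.n + 1) = a := by
    rw [Nat.add_comm, Nat.add_mul_div_right _ _ (by omega), Nat.div_eq_of_lt (by omega), zero_add]
  have h3 : (a * (d.n + 1) + b) % (d.n + 1) = b := by
    rw [Nat.add_comm, Nat.add_mul_mod_self_right, Nat.mod_eq_of_lt (by omega)]
  rw [Rel, relCode, testBit_bitCode, h2, h3]
  exact and_iff_right h1

/-- The set of states reached from `a` is one of the closed sets `Z`, and it is contained in all
closed sets that contain `a`. -/
theorem closure_iff (d : NumOCA) {X : ℕ → ℕ → Prop} (hX : ∀ u v, X u v → u ≤ d.n ∧ v ≤ d.n)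
    {a b : ℕ} (ha : a ≤ d.n) : d.Closure X a b ↔ ReflTransGen X a b := by
  constructor
  · intro h
    have := h (bitCode (d.n + 1) (ReflTransGen X a)) (bitCode_lt _ _)
      ((testBit_bitCode _ _ _).2 ⟨by omega, .refl⟩) fun u _ v hv hu huv =>
        (testBit_bitCode _ _ _).2 ⟨by omega, ((testBit_bitCode _ _ _).1 hu).2.tail huv⟩
    exact ((testBit_bitCode _ _ _).1 this).2
  · intro h Z _ hZ hcl
    induction h with
    | refl => exact hZ
    | tail _ h ih => exact hcl _ (hX _ _ h).1 _ (hX _ _ h).2 ih h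

/-- `Silent.Dip` with bounded quantifiers, for a coded relation. -/
def Dip (d : NumOCA) (x R a b : ℕ) : Prop :=
  ∃ u ≤ d.n, ∃ v ≤ d.n, d.Dec (x + 1) a u ∧ d.Rel R u v ∧ d.Inc x v b

/-- The excursions above `x`, for a coded relation. -/
def Bump (d : NumOCA) (x R a b : ℕ) : Prop :=
  ∃ u ≤ d.n, ∃ v ≤ d.n, d.Inc x a u ∧ d.Rel R u v ∧ d.Dec (x + 1) v b

/-- The code of the relation `Silent.Down` at level `x`. -/
noncomputable def downCode (d : NumOCA) (x : ℕ) : ℕ :=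
  Nat.rec (d.relCode Eq) (fun y R => d.relCode (d.Closure (d.Dip y R))) x

/-- The relation `Silent.Up` at the levels from the threshold on, as the least relation with its
closure properties. -/
def TopUp (d : NumOCA) (a b : ℕ) : Prop :=
  ∀ R < 2 ^ (d.n + 1) ^ 2, (∀ a ≤ d.n, d.Rel R a a) →
    (∀ a ≤ d.n, ∀ v ≤ d.n, ∀ b ≤ d.n, d.Bump d.m R a v → d.Rel R v b → d.Rel R a b) → d.Rel R a b

/-- The code of the relation `Silent.Up` at level `d.m - j`. -/
noncomputable def upCode (d : NumOCA) (j : ℕ) : ℕ :=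
  Nat.rec (d.relCode d.TopUp) (fun i R => d.relCode (d.Closure (d.Bump (d.m - (i + 1)) R))) j

/-- The paths from level `x` to level `x` that visit `x` only at the ends. -/
def FlatStep (d : NumOCA) (x a b : ℕ) : Prop :=
  (x ≠ 0 ∧ d.Dip (x - 1) (d.downCode (x - 1)) a b) ∨ d.Bump x (d.upCode (d.m - (x + 1))) a b

/-- The paths from level `x` to level `x`. -/
def Flat (d : NumOCA) (x a b : ℕ) : Prop := d.Closure (d.FlatStep x) a b

theorem Dip.le {d : NumOCA} {x R a b : ℕ} (h : d.Dip x R a b) : a ≤ d.n ∧ b ≤ d.n := by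
  obtain ⟨u, -, v, -, h1, -, h2⟩ := h
  exact ⟨h1.le.1, h2.le.2⟩

theorem Bump.le {d : NumOCA} {x R a b : ℕ} (h : d.Bump x R a b) : a ≤ d.n ∧ b ≤ d.n := by
  obtain ⟨u, -, v, -, h1, -, h2⟩ := h
  exact ⟨h1.le.1, h2.le.2⟩

theorem FlatStep.le {d : NumOCA} {x a b : ℕ} (h : d.FlatStep x a b) : a ≤ d.n ∧ b ≤ d.n := by
  rcases h with ⟨-, h⟩ | h
  exacts [h.le, h.le]

theorem downCode_succ (d : NumOCA) (x : ℕ) :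
    d.downCode (x + 1) = d.relCode (d.Closure (d.Dip x (d.downCode x))) := rfl

theorem upCode_succ (d : NumOCA) (j : ℕ) :
    d.upCode (j + 1) = d.relCode (d.Closure (d.Bump (d.m - (j + 1)) (d.upCode j))) := rfl

theorem downCode_lt (d : NumOCA) (x : ℕ) : d.downCode x < 2 ^ (d.n + 1) ^ 2 := by
  cases x <;> exact relCode_lt _ _

theorem upCode_lt (d : NumOCA) (x : ℕ) : d.upCode x < 2 ^ (d.n + 1) ^ 2 := by
  cases x <;> exact relCode_lt _ _

theorem dip_iff (d : NumOCA) {x R : ℕ} {X : ℕ → ℕ → Prop}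
    (h : ∀ a ≤ d.n, ∀ b ≤ d.n, d.Rel R a b ↔ X a b) {a b : ℕ} :
    d.Dip x R a b ↔ Silent.Dip d.Inc d.Dec x X a b := by
  constructor
  · rintro ⟨u, hu, v, hv, h1, h2, h3⟩
    exact ⟨u, v, h1, (h u hu v hv).1 h2, h3⟩
  · rintro ⟨u, v, h1, h2, h3⟩
    exact ⟨u, h1.le.2, v, h3.le.1, h1, (h u h1.le.2 v h3.le.1).2 h2, h3⟩

theorem rel_downCode (d : NumOCA) (x : ℕ) : ∀ a ≤ d.n, ∀ b ≤ d.n,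
    (d.Rel (d.downCode x) a b ↔ Silent.Down d.Inc d.Dec x a b) := by
  induction x with
  | zero => exact fun a ha b hb => d.rel_relCode ha hb
  | succ x ih =>
    intro a ha b hb
    rw [downCode_succ, rel_relCode d ha hb, closure_iff d (fun _ _ h => h.le) ha]
    have : d.Dip x (d.downCode x) = Silent.Dip d.Inc d.Dec x (Silent.Down d.Inc d.Dec x) := by
      funext a b
      exact propext (d.dip_iff ih)
    rw [this]
    rfl

theorem bump_iff (d : NumOCA) {x R : ℕ}
    (h : ∀ a ≤ d.n, ∀ b ≤ d.n, d.Rel R a b ↔ Silent.Up d.Inc d.Dec (x + 1) a b) {a b : ℕ} :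
    d.Bump x R a b ↔ Silent.UpStep d.Inc d.Dec x a b := by
  constructor
  · rintro ⟨u, hu, v, hv, h1, h2, h3⟩
    exact ⟨u, v, h1, (h u hu v hv).1 h2, h3⟩
  · rintro ⟨u, v, h1, h2, h3⟩
    exact ⟨u, h1.le.2, v, h3.le.1, h1, (h u h1.le.2 v h3.le.1).2 h2, h3⟩

/-- From the threshold on the transitions are constant, so one relation can serve at all levels. The
code of `Up` satisfies the closure conditions because `Up` passes from level `x` to level `x + 1`
(`Silent.Up.succ`); conversely, induction on `Up` places it inside every relation that satisfies
them. -/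
theorem topUp_iff (d : NumOCA) {x a b : ℕ} (hx : d.m ≤ x) (ha : a ≤ d.n) (hb : b ≤ d.n) :
    d.TopUp a b ↔ Silent.Up d.Inc d.Dec x a b := by
  have hI : ∀ y z, d.m ≤ y → d.m ≤ z → d.Inc y = d.Inc z := fun y z hy hz =>
    d.inc_congr (by omega)
  have hD : ∀ y z, d.m ≤ y → d.m ≤ z → d.Dec y = d.Dec z := fun y z hy hz =>
    d.dec_congr (by omega)
  constructor
  · intro h
    refine (d.rel_relCode ha hb).1 (h _ (d.relCode_lt (Silent.Up d.Inc d.Dec x))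
      (fun a ha => (d.rel_relCode ha ha).2 (.refl _ _)) fun a ha v hv b hb h1 h2 => ?_)
    rw [rel_relCode d hv hb] at h2
    rw [rel_relCode d ha hb]
    obtain ⟨u, hu, w, hw, h3, h4, h5⟩ := h1
    rw [rel_relCode d hu hw] at h4
    refine .step (by rwa [hI x d.m hx le_rfl]) (h4.succ (fun y hy => hI _ _ (by omega) hy)
      (fun y hy => hD _ _ (by omega) hy) hx)
      (by rwa [hD (x + 1) (d.m + 1) (by omega) (by omega)]) h2
  · intro h R _ hrefl hstep
    induction h with
    | refl x a => exact hrefl a ha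
    | @step x a u v b c h1 _ h3 _ ih ih' =>
      have h1' := h1.le
      have h3' := h3.le
      refine hstep a ha b h3'.2 c hb ⟨u, h1'.2, v, h3'.1, ?_, ih (by omega) h1'.2 h3'.1, ?_⟩
        (ih' hx h3'.2 hb)
      · rwa [hI d.m x le_rfl hx]
      · rwa [hD (d.m + 1) (x + 1) (by omega) (by omega)]

/-- Truncated subtraction gives all levels from the threshold on the index `0`; below it each level
is obtained from the next higher one. -/
theorem rel_upCode (d : NumOCA) (x : ℕ) : ∀ a ≤ d.n, ∀ b ≤ d.n,
    (d.Rel (d.upCode (d.m - x)) a b ↔ Silent.Up d.Inc d.Dec x a b) := by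
  obtain ⟨j, hj⟩ : ∃ j, d.m - x = j := ⟨_, rfl⟩
  rw [hj]
  induction j generalizing x with
  | zero =>
    intro a ha b hb
    exact (d.rel_relCode ha hb).trans (d.topUp_iff (by omega) ha hb)
  | succ j ih =>
    intro a ha b hb
    rw [upCode_succ, rel_relCode d ha hb, closure_iff d (fun _ _ h => h.le) ha, Silent.up_iff]
    have : d.Bump (d.m - (j + 1)) (d.upCode j) = Silent.UpStep d.Inc d.Dec x := by
      funext a b
      rw [show d.m - (j + 1) = x by omega]
      exact propext (d.bump_iff (ih (x + 1) (by omega)))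
    rw [this]

theorem flat_iff (d : NumOCA) {x a b : ℕ} (ha : a ≤ d.n) :
    d.Flat x a b ↔ Silent.Flat d.Inc d.Dec x a b := by
  rw [Flat, closure_iff d (fun _ _ h => h.le) ha]
  have : d.FlatStep x = fun a b =>
      Silent.DownStep d.Inc d.Dec x a b ∨ Silent.UpStep d.Inc d.Dec x a b := by
    funext a b
    refine propext (or_congr ?_ (d.bump_iff (d.rel_upCode (x + 1))))
    cases x with
    | zero => simp [Silent.DownStep]
    | succ x =>
      simp only [ne_eq, Nat.succ_ne_zero, not_false_eq_true, true_and, Nat.add_sub_cancel]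
      exact d.dip_iff (d.rel_downCode x)
  rw [this]
  rfl

/-! #### Periodicity -/

/-- A level from which on `downCode` is periodic. -/
def base (d : NumOCA) : ℕ := d.m + 2 ^ (d.n + 1) ^ 2

open Classical in
/-- A period of `downCode` from the level `d.base` on. -/
noncomputable def period (d : NumOCA) : ℕ :=
  Nat.findGreatest (fun r => d.downCode (d.base + r) = d.downCode d.base) (2 ^ (d.n + 1) ^ 2)

/-- Beyond the threshold the recursion step is independent of the level, so an equality of codes
propagates upwards. -/
theorem downCode_shift (d : NumOCA) {x y : ℕ} (hx : d.m ≤ x) (hy : d.m ≤ y)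
    (h : d.downCode x = d.downCode y) (j : ℕ) : d.downCode (x + j) = d.downCode (y + j) := by
  induction j with
  | zero => exact h
  | succ j ih =>
    rw [← Nat.add_assoc, ← Nat.add_assoc, downCode_succ, downCode_succ, ih]
    congr 2
    funext a b
    rw [Dip, Dip, d.inc_congr (show min (x + j) d.m = min (y + j) d.m by omega),
      d.dec_congr (show min (x + j + 1) d.m = min (y + j + 1) d.m by omega)]

/-- By pigeonhole, two of the `2 ^ (d.n + 1) ^ 2 + 1` levels from `d.m` to `d.base` have the same
code. Shifting the repetition up to `d.base` makes their distance a positive candidate for the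
search. -/
theorem period_spec (d : NumOCA) :
    0 < d.period ∧ d.downCode (d.base + d.period) = d.downCode d.base := by
  obtain ⟨i, hi, j, hj, hij, h⟩ : ∃ i ∈ Finset.range (2 ^ (d.n + 1) ^ 2 + 1),
      ∃ j ∈ Finset.range (2 ^ (d.n + 1) ^ 2 + 1), i ≠ j ∧
        d.downCode (d.m + i) = d.downCode (d.m + j) :=
    Finset.exists_ne_map_eq_of_card_lt_of_maps_to (t := Finset.range (2 ^ (d.n + 1) ^ 2))
      (by simp) fun i _ => Finset.mem_coe.2 (Finset.mem_range.2 (d.downCode_lt _))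
  wlog hlt : i < j generalizing i j
  · exact this j hj i hi hij.symm h.symm (by omega)
  rw [Finset.mem_range] at hi hj
  have h' := d.downCode_shift (by omega) (by omega) h (2 ^ (d.n + 1) ^ 2 - i)
  rw [show d.m + i + (2 ^ (d.n + 1) ^ 2 - i) = d.base by unfold base; omega,
    show d.m + j + (2 ^ (d.n + 1) ^ 2 - i) = d.base + (j - i) by unfold base; omega] at h'
  have hle : j - i ≤ 2 ^ (d.n + 1) ^ 2 := by omega
  classical
  constructor
  · refine lt_of_lt_of_le (show 0 < j - i by omega) ?_
    unfold period
    convert Nat.le_findGreatest (P := fun r => d.downCode (d.base + r) = d.downCode d.base) hle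
      h'.symm
  · have := Nat.findGreatest_spec (P := fun r => d.downCode (d.base + r) = d.downCode d.base) hle
      h'.symm
    unfold period
    convert this

theorem downCode_congr (d : NumOCA) {x y : ℕ} (hx : d.base ≤ x) (hy : d.base ≤ y)
    (h : x ≡ y [MOD d.period]) : d.downCode x = d.downCode y := by
  have hm : d.m ≤ d.base := Nat.le_add_right _ _
  have hper : Function.Periodic (fun j => d.downCode (d.base + j)) d.period := fun j => by
    have := d.downCode_shift (by omega) hm d.period_spec.2 j
    dsimp only
    rw [← this]
    congr 1
    omega
  obtain ⟨i, rfl⟩ := Nat.exists_eq_add_of_le hx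
  obtain ⟨j, rfl⟩ := Nat.exists_eq_add_of_le hy
  have hij : i % d.period = j % d.period := Nat.ModEq.add_left_cancel' d.base h
  have h1 := hper.map_mod_nat i
  have h2 := hper.map_mod_nat j
  rw [← h1, ← h2, hij]

/-- The inequalities are strict because excursions below `x` use `downCode (x - 1)`, and `x - 1`
must lie in the periodic range already. Excursions above `x` are constant there. -/
theorem flat_congr (d : NumOCA) {x y : ℕ} (hx : d.base < x) (hy : d.base < y)
    (h : x ≡ y [MOD d.period]) : d.Flat x = d.Flat y := by
  have hm : d.m ≤ d.base := Nat.le_add_right _ _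
  have h' : x - 1 ≡ y - 1 [MOD d.period] := by
    refine Nat.ModEq.add_right_cancel' 1 ?_
    rwa [show x - 1 + 1 = x by omega, show y - 1 + 1 = y by omega]
  have h1 := d.downCode_congr (show d.base ≤ x - 1 by omega) (show d.base ≤ y - 1 by omega) h'
  have : d.FlatStep x = d.FlatStep y := by
    funext a b
    unfold FlatStep Dip Bump
    rw [h1, d.inc_congr (show min (x - 1) d.m = min (y - 1) d.m by omega),
      d.inc_congr (show min x d.m = min y d.m by omega),
      d.dec_congr (show min (x - 1 + 1) d.m = min (y - 1 + 1) d.m by omega),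
      d.dec_congr (show min (x + 1) d.m = min (y + 1) d.m by omega),
      show d.m - (x + 1) = d.m - (y + 1) by omega]
    simp only [show x ≠ 0 by omega, show y ≠ 0 by omega, ne_eq, not_false_eq_true, true_and]
  funext a b
  rw [Flat, Flat, this]

end NumOCA

namespace NumOCA

open RAM

/-! #### The deterministic automaton for the complement, by numbers

A state codes a set of states of `d`, the residue of the counter value modulo the period, and a
mode: `0` after a letter, `1` and `2` after increments and decrements, `3` for failure. -/

/-- The number of states. -/
noncomputable def detCard (d : NumOCA) : ℕ := 2 ^ (d.n + 1) * d.period * 4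

/-- The state with the given components. -/
noncomputable def pack (d : NumOCA) (Z c k : ℕ) : ℕ := (Z * d.period + c) * 4 + k

/-- The set of states of `d` in the state `i`. -/
noncomputable def setOf (d : NumOCA) (i : ℕ) : ℕ := i / 4 / d.period

/-- The residue of the counter value in the state `i`. -/
noncomputable def resOf (d : NumOCA) (i : ℕ) : ℕ := i / 4 % d.period

/-- A counter value that is equivalent to all those with counter test `k` and residue `c`. -/
noncomputable def rep (d : NumOCA) (k c : ℕ) : ℕ :=
  if k ≤ d.base + 1 then k else c + d.period * (d.base + 2)

/-- The states that are reached from the set `Z` by `X` and a path from level `y` to level `y`. -/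
noncomputable def next (d : NumOCA) (y : ℕ) (X : ℕ → ℕ → Prop) (Z : ℕ) : ℕ :=
  bitCode (d.n + 1) fun b => ∃ a ≤ d.n, ∃ u ≤ d.n, Z.testBit a = true ∧ X a u ∧ d.Flat y u b

/-- The successor of `i` by a letter. -/
noncomputable def letterSucc (d : NumOCA) (i x j : ℕ) : ℕ :=
  if i % 4 = 3 then 3 else d.pack (d.next x (d.Trans (min x d.m) j) (d.setOf i)) (d.resOf i) 0

/-- The successor of `i` by an increment. -/
noncomputable def incSucc (d : NumOCA) (i x : ℕ) : ℕ :=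
  if 2 ≤ i % 4 then 3 else
    d.pack (d.next (x + 1) (d.Inc x) (d.setOf i)) ((d.resOf i + 1) % d.period) 1

/-- The successor of `i` by a decrement. -/
noncomputable def decSucc (d : NumOCA) (i x : ℕ) : ℕ :=
  if i % 2 = 1 then 3 else
    d.pack (d.next (x - 1) (d.Dec x) (d.setOf i)) ((d.resOf i + (d.period - 1)) % d.period) 2

/-- The successor of `i` by the symbol `j` under the counter test `k`. -/
noncomputable def delta (d : NumOCA) (i k j : ℕ) : ℕ :=
  if j < d.s then d.letterSucc i (d.rep k (d.resOf i)) j else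
    if j = d.s then d.incSucc i (d.rep k (d.resOf i)) else d.decSucc i (d.rep k (d.resOf i))

/-- The initial state. -/
noncomputable def detStart (d : NumOCA) : ℕ :=
  d.pack (bitCode (d.n + 1) fun b => d.Flat 0 d.q0 b) 0 0

/-- The final states. -/
def DetFinal (d : NumOCA) (i : ℕ) : Prop := i % 4 = 0 ∧ ¬ (d.setOf i).testBit d.n = true

/-- The encoding of the automaton. -/
noncomputable def detEncode (d : NumOCA) : List ℕ :=
  [d.detCard, d.s, d.base + 2, d.detStart] ++
  (List.range d.detCard).flatMap (fun i => [OCA.bit (d.DetFinal i)]) ++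
  (List.range d.detCard).flatMap fun i =>
    (List.range (d.base + 3)).flatMap fun k =>
      (List.range (d.s + 2)).flatMap fun j =>
        (List.range d.detCard).flatMap fun i' => [OCA.bit (i' = d.delta i k j)]

/-! #### Polynomial time -/

section PolyTime

variable {σ : Type*} [Ctx σ] {φ : σ → NumOCA} {x a b k j R : σ → ℕ}

open PolyTime PolyDec

theorem polyTime_n (hφ : Renaming φ) : PolyTime (fun y => (φ y).n) :=
  (var (σ := NumOCA) (i := 0) (by decide)).rename hφ

theorem polyTime_s (hφ : Renaming φ) : PolyTime (fun y => (φ y).s) :=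
  (var (σ := NumOCA) (i := 1) (by decide)).rename hφ

theorem polyTime_m (hφ : Renaming φ) : PolyTime (fun y => (φ y).m) :=
  (var (σ := NumOCA) (i := 2) (by decide)).rename hφ

theorem polyTime_q0 (hφ : Renaming φ) : PolyTime (fun y => (φ y).q0) :=
  (var (σ := NumOCA) (i := 3) (by decide)).rename hφ

theorem polyTime_c (hφ : Renaming φ) : PolyTime (fun y => (φ y).c) :=
  (var (σ := NumOCA) (i := 4) (by decide)).rename hφ

theorem polyTime_p (hφ : Renaming φ) : PolyTime (fun y => (φ y).p) :=
  (var (σ := NumOCA) (i := 5) (by decide)).rename hφ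

theorem polyTime_sq (hφ : Renaming φ) : PolyTime (fun y => ((φ y).n + 1) ^ 2) :=
  (((polyTime_n hφ).succ).mul (polyTime_n hφ).succ).of_eq fun _ => (sq _).symm

theorem polyTime_two_pow_sq (hφ : Renaming φ) : PolyTime (fun y => 2 ^ ((φ y).n + 1) ^ 2) :=
  two_pow (polyTime_sq hφ) (polyTime_p hφ).1 fun y => (φ y).two_pow_sq_le

theorem polyTime_two_pow (hφ : Renaming φ) : PolyTime (fun y => 2 ^ ((φ y).n + 1)) :=
  two_pow (polyTime_n hφ).succ (polyTime_p hφ).1 fun y => (φ y).two_pow_le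

theorem polyTime_base (hφ : Renaming φ) : PolyTime (fun y => (φ y).base) :=
  (polyTime_m hφ).add (polyTime_two_pow_sq hφ)

theorem polyDec_trans (hφ : Renaming φ) (hk : PolyTime k) (hj : PolyTime j) (ha : PolyTime a)
    (hb : PolyTime b) : PolyDec (fun y => (φ y).Trans (k y) (j y) (a y) (b y)) :=
  .and (.lt ha (polyTime_n hφ)) (.and (.lt hb (polyTime_n hφ)) (.testBit (polyTime_c hφ)
    (.add (polyTime_n hφ) (.add (.mul (.add (.mul (.add (.mul ha (polyTime_m hφ).succ) hk)
      (polyTime_s hφ).succ.succ) hj) (polyTime_n hφ)) hb))))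

theorem polyDec_inc (hφ : Renaming φ) (hx : PolyTime x) (ha : PolyTime a) (hb : PolyTime b) :
    PolyDec (fun y => (φ y).Inc (x y) (a y) (b y)) :=
  .or (polyDec_trans hφ (hx.min (polyTime_m hφ)) (polyTime_s hφ) ha hb)
    (.and (.eq hb (polyTime_n hφ)) (.or (.eq ha (polyTime_n hφ))
      (.and (.lt ha (polyTime_n hφ)) (.testBit (polyTime_c hφ) ha))))

theorem polyDec_dec (hφ : Renaming φ) (hx : PolyTime x) (ha : PolyTime a) (hb : PolyTime b) :
    PolyDec (fun y => (φ y).Dec (x y) (a y) (b y)) :=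
  .or (polyDec_trans hφ (hx.min (polyTime_m hφ)) (polyTime_s hφ).succ ha hb)
    (.and (.eq hb (polyTime_n hφ)) (.eq ha (polyTime_n hφ)))

/-- Trying all `2 ^ (d.n + 1)` sets is polynomial because `d.p` is one of the numbers of the
context. -/
theorem polyDec_closure {X : σ → ℕ → ℕ → Prop} (hφ : Renaming φ)
    (hX : PolyDec fun z : (σ × ℕ) × ℕ => X z.1.1 z.1.2 z.2) (ha : PolyTime a) (hb : PolyTime b) :
    PolyDec (fun y => (φ y).Closure (X y) (a y) (b y)) :=
  .forall_lt (polyTime_two_pow hφ) (.imp (.testBit snd ha.fst)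
    (.imp (.forall_le (polyTime_n hφ.fst) (.forall_le (polyTime_n hφ.fst.fst)
      (.imp (.testBit snd.fst.fst snd.fst)
        (.imp (hX.comp₂ Renaming.refl.fst.fst.fst snd.fst snd) (.testBit snd.fst.fst snd)))))
      (.testBit snd hb.fst)))

theorem polyDec_rel (hφ : Renaming φ) (hR : PolyTime R) (ha : PolyTime a) (hb : PolyTime b) :
    PolyDec (fun y => (φ y).Rel (R y) (a y) (b y)) :=
  .testBit hR (.add (.mul ha (polyTime_n hφ).succ) hb)

theorem polyTime_relCode {X : σ → ℕ → ℕ → Prop} (hφ : Renaming φ)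
    (hX : PolyDec fun z : (σ × ℕ) × ℕ => X z.1.1 z.1.2 z.2) :
    PolyTime (fun y => (φ y).relCode (X y)) :=
  .bitCode (p := fun y i => X y (i / ((φ y).n + 1)) (i % ((φ y).n + 1))) (polyTime_sq hφ)
    (hX.comp₂ Renaming.refl.fst (.div snd (polyTime_n hφ.fst).succ)
      (.mod snd (polyTime_n hφ.fst).succ))
    (polyTime_p hφ).1 fun y => (φ y).two_pow_sq_le

theorem polyDec_dip (hφ : Renaming φ) (hx : PolyTime x) (hR : PolyTime R) (ha : PolyTime a)
    (hb : PolyTime b) : PolyDec (fun y => (φ y).Dip (x y) (R y) (a y) (b y)) :=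
  .exists_le (polyTime_n hφ) (.exists_le (polyTime_n hφ.fst)
    (.and (polyDec_dec hφ.fst.fst hx.succ.fst.fst ha.fst.fst snd.fst)
      (.and (polyDec_rel hφ.fst.fst hR.fst.fst snd.fst snd)
        (polyDec_inc hφ.fst.fst hx.fst.fst snd hb.fst.fst))))

theorem polyDec_bump (hφ : Renaming φ) (hx : PolyTime x) (hR : PolyTime R) (ha : PolyTime a)
    (hb : PolyTime b) : PolyDec (fun y => (φ y).Bump (x y) (R y) (a y) (b y)) :=
  .exists_le (polyTime_n hφ) (.exists_le (polyTime_n hφ.fst)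
    (.and (polyDec_inc hφ.fst.fst hx.fst.fst ha.fst.fst snd.fst)
      (.and (polyDec_rel hφ.fst.fst hR.fst.fst snd.fst snd)
        (polyDec_dec hφ.fst.fst hx.succ.fst.fst snd hb.fst.fst))))

theorem polyTime_closure_dip (hφ : Renaming φ) (hx : PolyTime x) (hR : PolyTime R) :
    PolyTime (fun y => (φ y).relCode ((φ y).Closure ((φ y).Dip (x y) (R y)))) := by
  have h1 : PolyDec fun z : (((σ × ℕ) × ℕ) × ℕ) × ℕ =>
      (φ z.1.1.1.1).Dip (x z.1.1.1.1) (R z.1.1.1.1) z.1.2 z.2 :=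
    polyDec_dip hφ.fst.fst.fst.fst hx.fst.fst.fst.fst hR.fst.fst.fst.fst snd.fst snd
  have h2 : PolyDec fun z : (σ × ℕ) × ℕ =>
      (φ z.1.1).Closure ((φ z.1.1).Dip (x z.1.1) (R z.1.1)) z.1.2 z.2 :=
    polyDec_closure (X := fun z => (φ z.1.1).Dip (x z.1.1) (R z.1.1)) hφ.fst.fst h1 snd.fst snd
  exact polyTime_relCode (X := fun y => (φ y).Closure ((φ y).Dip (x y) (R y))) hφ h2

theorem polyTime_downCode (hφ : Renaming φ) (hx : PolyTime x) :
    PolyTime (fun y => (φ y).downCode (x y)) :=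
  (rec_nat (g := fun y i R => (φ y).relCode ((φ y).Closure ((φ y).Dip i R)))
    (h := fun y => (φ y).relCode Eq) (b := fun y => (φ y).p) hx
    (polyTime_relCode (X := fun _ => Eq) hφ (.eq snd.fst snd))
    (polyTime_closure_dip (φ := fun z : (σ × ℕ) × ℕ => φ z.1.1) (x := fun z => z.1.2)
      (R := fun z => z.2) hφ.fst.fst (fst snd) snd)
    (polyTime_p hφ).1
    fun y i _ => show (φ y).downCode i ≤ (φ y).p from
      ((φ y).downCode_lt i).le.trans (φ y).two_pow_sq_le).of_eq fun _ => rfl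

theorem polyDec_topUp (hφ : Renaming φ) (ha : PolyTime a) (hb : PolyTime b) :
    PolyDec (fun y => (φ y).TopUp (a y) (b y)) :=
  .forall_lt (polyTime_two_pow_sq hφ) (.imp
    (.forall_le (polyTime_n hφ.fst) (polyDec_rel hφ.fst.fst snd.fst snd snd))
    (.imp (.forall_le (polyTime_n hφ.fst) (.forall_le (polyTime_n hφ.fst.fst)
      (.forall_le (polyTime_n hφ.fst.fst.fst)
        (.imp (polyDec_bump hφ.fst.fst.fst.fst (polyTime_m hφ.fst.fst.fst.fst) snd.fst.fst.fst
          snd.fst.fst snd.fst)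
        (.imp (polyDec_rel hφ.fst.fst.fst.fst snd.fst.fst.fst snd.fst snd)
          (polyDec_rel hφ.fst.fst.fst.fst snd.fst.fst.fst snd.fst.fst snd))))))
      (polyDec_rel hφ.fst snd ha.fst hb.fst)))

theorem polyTime_closure_bump (hφ : Renaming φ) (hx : PolyTime x) (hR : PolyTime R) :
    PolyTime (fun y => (φ y).relCode ((φ y).Closure ((φ y).Bump (x y) (R y)))) := by
  have h1 : PolyDec fun z : (((σ × ℕ) × ℕ) × ℕ) × ℕ =>
      (φ z.1.1.1.1).Bump (x z.1.1.1.1) (R z.1.1.1.1) z.1.2 z.2 :=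
    polyDec_bump hφ.fst.fst.fst.fst hx.fst.fst.fst.fst hR.fst.fst.fst.fst snd.fst snd
  have h2 : PolyDec fun z : (σ × ℕ) × ℕ =>
      (φ z.1.1).Closure ((φ z.1.1).Bump (x z.1.1) (R z.1.1)) z.1.2 z.2 :=
    polyDec_closure (X := fun z => (φ z.1.1).Bump (x z.1.1) (R z.1.1)) hφ.fst.fst h1 snd.fst snd
  exact polyTime_relCode (X := fun y => (φ y).Closure ((φ y).Bump (x y) (R y))) hφ h2

theorem polyTime_upCode (hφ : Renaming φ) (hx : PolyTime x) :
    PolyTime (fun y => (φ y).upCode (x y)) :=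
  (rec_nat (g := fun y i R => (φ y).relCode ((φ y).Closure ((φ y).Bump ((φ y).m - (i + 1)) R)))
    (h := fun y => (φ y).relCode (φ y).TopUp) (b := fun y => (φ y).p) hx
    (polyTime_relCode (X := fun y => (φ y).TopUp) hφ (polyDec_topUp hφ.fst.fst snd.fst snd))
    (polyTime_closure_bump (φ := fun z : (σ × ℕ) × ℕ => φ z.1.1)
      (x := fun z => (φ z.1.1).m - (z.1.2 + 1)) (R := fun z => z.2) hφ.fst.fst
      (sub (polyTime_m hφ.fst.fst) (succ (fst snd))) snd)
    (polyTime_p hφ).1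
    fun y i _ => show (φ y).upCode i ≤ (φ y).p from
      ((φ y).upCode_lt i).le.trans (φ y).two_pow_sq_le).of_eq fun _ => rfl

theorem polyDec_flat (hφ : Renaming φ) (hx : PolyTime x) (ha : PolyTime a) (hb : PolyTime b) :
    PolyDec (fun y => (φ y).Flat (x y) (a y) (b y)) :=
  polyDec_closure (X := fun y => (φ y).FlatStep (x y)) hφ
    (.or (.and (.not (.eq_zero hx.fst.fst)) (polyDec_dip hφ.fst.fst hx.pred.fst.fst
        (polyTime_downCode hφ.fst.fst hx.pred.fst.fst) snd.fst snd))
      (polyDec_bump hφ.fst.fst hx.fst.fst (polyTime_upCode hφ.fst.fst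
        ((polyTime_m hφ.fst.fst).sub hx.succ.fst.fst)) snd.fst snd)) ha hb

theorem polyTime_period (hφ : Renaming φ) : PolyTime (fun y => (φ y).period) :=
  findGreatest (p := fun y r => (φ y).downCode ((φ y).base + r) = (φ y).downCode (φ y).base)
    (polyTime_two_pow_sq hφ)
    (.eq (polyTime_downCode hφ.fst ((polyTime_base hφ.fst).add snd))
      (polyTime_downCode hφ.fst (polyTime_base hφ.fst)))

theorem polyTime_detCard (hφ : Renaming φ) : PolyTime (fun y => (φ y).detCard) :=
  .mul (.mul (polyTime_two_pow hφ) (polyTime_period hφ)) (.const 4)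

theorem polyTime_pack (hφ : Renaming φ) (hx : PolyTime x) (ha : PolyTime a) (hb : PolyTime b) :
    PolyTime (fun y => (φ y).pack (x y) (a y) (b y)) :=
  .add (.mul (.add (.mul hx (polyTime_period hφ)) ha) (.const 4)) hb

theorem polyTime_setOf (hφ : Renaming φ) (hx : PolyTime x) :
    PolyTime (fun y => (φ y).setOf (x y)) := .div (.div hx (.const 4)) (polyTime_period hφ)

theorem polyTime_resOf (hφ : Renaming φ) (hx : PolyTime x) :
    PolyTime (fun y => (φ y).resOf (x y)) := .mod (.div hx (.const 4)) (polyTime_period hφ)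

theorem polyTime_rep (hφ : Renaming φ) (ha : PolyTime a) (hb : PolyTime b) :
    PolyTime (fun y => (φ y).rep (a y) (b y)) :=
  .ite (.le ha (polyTime_base hφ).succ) ha
    (.add hb (.mul (polyTime_period hφ) (polyTime_base hφ).succ.succ))

theorem polyTime_next {X : σ → ℕ → ℕ → Prop} (hφ : Renaming φ) (hx : PolyTime x)
    (hX : PolyDec fun z : (σ × ℕ) × ℕ => X z.1.1 z.1.2 z.2) (ha : PolyTime a) :
    PolyTime (fun y => (φ y).next (x y) (X y) (a y)) :=
  .bitCode (p := fun y b => ∃ a' ≤ (φ y).n, ∃ u ≤ (φ y).n,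
      (a y).testBit a' = true ∧ X y a' u ∧ (φ y).Flat (x y) u b) (polyTime_n hφ).succ
    (.exists_le (polyTime_n hφ.fst) (.exists_le (polyTime_n hφ.fst.fst)
      (.and (.testBit ha.fst.fst.fst snd.fst)
        (.and (hX.comp₂ Renaming.refl.fst.fst.fst snd.fst snd)
          (polyDec_flat hφ.fst.fst.fst hx.fst.fst.fst snd snd.fst.fst)))))
    (polyTime_p hφ).1 fun y => (φ y).two_pow_le

theorem polyTime_delta (hφ : Renaming φ) (ha : PolyTime a) (hk : PolyTime k) (hj : PolyTime j) :
    PolyTime (fun y => (φ y).delta (a y) (k y) (j y)) := by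
  have hx := polyTime_rep hφ hk (polyTime_resOf hφ ha)
  have hr := polyTime_resOf hφ ha
  have hZ := polyTime_setOf hφ ha
  have hp := polyTime_period hφ
  refine .ite (.lt hj (polyTime_s hφ)) ?_ (.ite (.eq hj (polyTime_s hφ)) ?_ ?_)
  · exact .ite (.eq (.mod ha (.const 4)) (.const 3)) (.const 3) (polyTime_pack hφ
      (polyTime_next (X := fun y => (φ y).Trans
        (min ((φ y).rep (k y) ((φ y).resOf (a y))) (φ y).m) (j y)) hφ hx
        (polyDec_trans hφ.fst.fst (PolyTime.min hx.fst.fst (polyTime_m hφ.fst.fst)) hj.fst.fst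
          snd.fst snd) hZ) hr (.const 0))
  · exact .ite (.le (.const 2) (.mod ha (.const 4))) (.const 3) (polyTime_pack hφ
      (polyTime_next (X := fun y => (φ y).Inc ((φ y).rep (k y) ((φ y).resOf (a y)))) hφ hx.succ
        (polyDec_inc hφ.fst.fst hx.fst.fst snd.fst snd) hZ) (.mod hr.succ hp) (.const 1))
  · exact .ite (.eq (.mod ha (.const 2)) (.const 1)) (.const 3) (polyTime_pack hφ
      (polyTime_next (X := fun y => (φ y).Dec ((φ y).rep (k y) ((φ y).resOf (a y)))) hφ hx.pred
        (polyDec_dec hφ.fst.fst hx.fst.fst snd.fst snd) hZ) (.mod (.add hr hp.pred) hp) (.const 2))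

theorem polyTime_detStart (hφ : Renaming φ) : PolyTime (fun y => (φ y).detStart) :=
  polyTime_pack hφ (.bitCode (p := fun y b => (φ y).Flat 0 (φ y).q0 b) (polyTime_n hφ).succ
    (polyDec_flat hφ.fst (.const 0) (polyTime_q0 hφ.fst) snd)
    (polyTime_p hφ).1 fun y => (φ y).two_pow_le) (.const 0) (.const 0)

theorem polyDec_detFinal (hφ : Renaming φ) (ha : PolyTime a) :
    PolyDec (fun y => (φ y).DetFinal (a y)) :=
  .and (.eq_zero (.mod ha (.const 4))) (.not (.testBit (polyTime_setOf hφ ha) (polyTime_n hφ)))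

theorem polyPrint_detEncode : PolyPrint detEncode := by
  have hφ : Renaming (fun d : NumOCA => d) := .refl
  refine .append (.append (.append (.singleton (polyTime_detCard hφ))
    (.append (.singleton (polyTime_s hφ)) (.append (.singleton (polyTime_base hφ).succ.succ)
      (.singleton (polyTime_detStart hφ))))) ?_) ?_
  · exact .flatMap_range (polyTime_detCard hφ) (.singleton (polyDec_detFinal hφ.fst snd))
  · refine .flatMap_range (polyTime_detCard hφ) ?_
    refine .flatMap_range (polyTime_base hφ.fst).succ.succ.succ ?_
    refine .flatMap_range (polyTime_s hφ.fst.fst).succ.succ ?_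
    refine .flatMap_range (polyTime_detCard hφ.fst.fst.fst) (.singleton ?_)
    exact PolyDec.eq snd (polyTime_delta hφ.fst.fst.fst.fst snd.fst.fst.fst snd.fst.fst snd.fst)

end PolyTime

end NumOCA

namespace NumOCA

open RAM

/-! #### Reachable configurations -/

section Reach

variable {α : Type v}

/-- The counter value at the last letter of a word, and `0` for the empty word. -/
def level (w : List (α × ℕ)) : ℕ := (w.getLast?.map Prod.snd).getD 0

theorem level_append (w : List (α × ℕ)) (l : α) (x : ℕ) : level (w ++ [(l, x)]) = x := by
  simp [level]

/-- `d.Reach e w q x`: with the observation `w`, where the letters are numbered by `e`, the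
state `q` can be reached with the counter value `x`. -/
inductive Reach (d : NumOCA) (e : α → ℕ) : List (α × ℕ) → ℕ → ℕ → Prop
  | start : Reach d e [] d.q0 0
  | inc {w : List (α × ℕ)} {a b x : ℕ} (h : Reach d e w a x) (ht : d.Inc x a b) :
      Reach d e w b (x + 1)
  | dec {w : List (α × ℕ)} {a b x : ℕ} (h : Reach d e w a (x + 1)) (ht : d.Dec (x + 1) a b) :
      Reach d e w b x
  | letter {w : List (α × ℕ)} {a b x : ℕ} {l : α} (h : Reach d e w a x)
      (ht : d.Trans (min x d.m) (e l) a b) : Reach d e (w ++ [(l, x)]) b x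

variable {d : NumOCA} {e : α → ℕ} {w : List (α × ℕ)} {a b x y : ℕ} {l : α}

theorem Reach.path {c c' : ℕ × ℕ} (h : Reach d e w c.1 c.2) (hp : Silent.Path d.Inc d.Dec c c') :
    Reach d e w c'.1 c'.2 := by
  change Relation.ReflTransGen _ _ _ at hp
  induction hp with
  | refl => exact h
  | tail _ hm ih =>
    cases hm with
    | inc hi => exact ih.inc hi
    | dec hi => exact ih.dec hi

/-- The states that are reached by the last letter of a word, or the initial state. -/
def Entry (d : NumOCA) (e : α → ℕ) (w : List (α × ℕ)) (u : ℕ) : Prop :=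
  w = [] ∧ u = d.q0 ∨
    ∃ w' l x a, w = w' ++ [(l, x)] ∧ Reach d e w' a x ∧ d.Trans (min x d.m) (e l) a u

theorem Entry.reach {u : ℕ} (h : Entry d e w u) : Reach d e w u (level w) := by
  rcases h with ⟨rfl, rfl⟩ | ⟨w', l, x, a, rfl, h, ht⟩
  · exact .start
  · rw [level_append]
    exact .letter h ht

/-- After the last letter only silent moves remain, and they start at the counter value `level w`.
-/
theorem Reach.exists_entry (h : Reach d e w b x) :
    ∃ u, Entry d e w u ∧ Silent.Path d.Inc d.Dec (u, level w) (b, x) := by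
  induction h with
  | start => exact ⟨d.q0, .inl ⟨rfl, rfl⟩, .refl⟩
  | inc _ ht ih =>
    obtain ⟨u, hu, hp⟩ := ih
    exact ⟨u, hu, hp.tail (.inc ht)⟩
  | dec _ ht ih =>
    obtain ⟨u, hu, hp⟩ := ih
    exact ⟨u, hu, hp.tail (.dec ht)⟩
  | letter h ht _ =>
    refine ⟨_, .inr ⟨_, _, _, _, rfl, h, ht⟩, ?_⟩
    rw [level_append]
    exact .refl

theorem Reach.le (hq : d.q0 < d.n) (h : Reach d e w b x) : b ≤ d.n := by
  cases h with
  | start => exact hq.le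
  | inc _ ht => exact ht.le.2
  | dec _ ht => exact ht.le.2
  | letter _ ht => exact ht.2.1.le

theorem reach_nil_iff (hq : d.q0 < d.n) : Reach d e [] b 0 ↔ d.Flat 0 d.q0 b := by
  rw [flat_iff d hq.le]
  constructor
  · intro h
    obtain ⟨u, hu, hp⟩ := h.exists_entry
    rcases hu with ⟨-, rfl⟩ | ⟨w', l, x, a, h', -⟩
    · exact Silent.path_iff_flat.1 hp
    · simp at h'
  · intro h
    exact Reach.start.path (c := (d.q0, 0)) h.path

/-- By `hx`, every run with observation `w` that ends at `x + 1` crosses from `x` to `x + 1` after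
its last letter. From a last letter at a higher level it could come down to `x + 1` without ever
visiting `x`. -/
theorem reach_succ_iff (hx : level w ≤ x) :
    Reach d e w b (x + 1) ↔ ∃ a u, Reach d e w a x ∧ d.Inc x a u ∧ d.Flat (x + 1) u b := by
  constructor
  · intro h
    obtain ⟨u, hu, hp⟩ := h.exists_entry
    obtain ⟨a, u', h1, h2, h3⟩ := hp.exists_inc hx
    exact ⟨a, u', hu.reach.path h1, h2, (flat_iff d h2.le.2).2 h3⟩
  · rintro ⟨a, u, h1, h2, h3⟩
    exact (h1.inc h2).path (c := (u, x + 1)) ((flat_iff d h2.le.2).1 h3).path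

theorem reach_pred_iff (hx : x < level w) :
    Reach d e w b x ↔ ∃ a u, Reach d e w a (x + 1) ∧ d.Dec (x + 1) a u ∧ d.Flat x u b := by
  constructor
  · intro h
    obtain ⟨u, hu, hp⟩ := h.exists_entry
    obtain ⟨a, u', h1, h2, h3⟩ := hp.exists_dec hx
    exact ⟨a, u', hu.reach.path h1, h2, (flat_iff d h2.le.2).2 h3⟩
  · rintro ⟨a, u, h1, h2, h3⟩
    exact (h1.dec h2).path (c := (u, x)) ((flat_iff d h2.le.2).1 h3).path

theorem reach_append_iff : Reach d e (w ++ [(l, x)]) b x ↔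
    ∃ a u, Reach d e w a x ∧ d.Trans (min x d.m) (e l) a u ∧ d.Flat x u b := by
  constructor
  · intro h
    obtain ⟨u, hu, hp⟩ := h.exists_entry
    rcases hu with ⟨h', -⟩ | ⟨w', l', x', a, h', h1, h2⟩
    · simp at h'
    · obtain ⟨rfl, hl⟩ := List.append_inj' h' rfl
      obtain ⟨rfl, rfl⟩ := Prod.mk.inj (List.cons.inj hl).1
      rw [level_append] at hp
      exact ⟨a, u, h1, h2, (flat_iff d h2.2.1.le).2 (Silent.path_iff_flat.1 hp)⟩
  · rintro ⟨a, u, h1, h2, h3⟩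
    exact (h1.letter h2).path (c := (u, x)) ((flat_iff d h2.2.1.le).1 h3).path

end Reach

/-! #### Invariant of the deterministic automaton -/

section Invariant

variable {α : Type v} {d : NumOCA} {e : α → ℕ} {w : List (α × ℕ)} {a b x i : ℕ} {l : α}

theorem pack_mod {Z c k : ℕ} (hk : k < 4) : d.pack Z c k % 4 = k := by
  unfold pack; omega

theorem pack_div {Z c k : ℕ} (hk : k < 4) : d.pack Z c k / 4 = Z * d.period + c := by
  unfold pack; omega

theorem setOf_pack {Z c k : ℕ} (hk : k < 4) (hc : c < d.period) : d.setOf (d.pack Z c k) = Z := by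
  rw [setOf, pack_div hk, Nat.add_comm, Nat.add_mul_div_right _ _ (by omega),
    Nat.div_eq_of_lt hc, zero_add]

theorem resOf_pack {Z c k : ℕ} (hk : k < 4) (hc : c < d.period) : d.resOf (d.pack Z c k) = c := by
  rw [resOf, pack_div hk, Nat.add_comm, Nat.add_mul_mod_self_right, Nat.mod_eq_of_lt hc]

theorem pack_lt {Z c k : ℕ} (hk : k < 4) (hc : c < d.period) (hZ : Z < 2 ^ (d.n + 1)) :
    d.pack Z c k < d.detCard := by
  have : (Z + 1) * d.period ≤ 2 ^ (d.n + 1) * d.period := Nat.mul_le_mul_right _ hZ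
  unfold pack detCard
  rw [Nat.succ_mul] at this
  omega

theorem resOf_lt (d : NumOCA) (i : ℕ) : d.resOf i < d.period := Nat.mod_lt _ d.period_spec.1

theorem three_lt_detCard (d : NumOCA) : 3 < d.detCard := by
  have : 1 * 1 ≤ 2 ^ (d.n + 1) * d.period := Nat.mul_le_mul Nat.one_le_two_pow d.period_spec.1
  unfold detCard
  omega

theorem next_lt (d : NumOCA) (y : ℕ) (X : ℕ → ℕ → Prop) (Z : ℕ) : d.next y X Z < 2 ^ (d.n + 1) :=
  bitCode_lt _ _

theorem delta_lt (d : NumOCA) (i k j : ℕ) : d.delta i k j < d.detCard := by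
  have hp := d.period_spec.1
  have h3 := d.three_lt_detCard
  unfold delta letterSucc incSucc decSucc
  split_ifs <;> first
    | exact h3
    | exact pack_lt (by omega) (d.resOf_lt i) (d.next_lt _ _ _)
    | exact pack_lt (by omega) (Nat.mod_lt _ hp) (d.next_lt _ _ _)

theorem detStart_lt (d : NumOCA) : d.detStart < d.detCard :=
  pack_lt (by omega) d.period_spec.1 (bitCode_lt _ _)

theorem testBit_next {y Z : ℕ} {X : ℕ → ℕ → Prop} {R : ℕ → Prop}
    (hZ : ∀ a, Z.testBit a = true ↔ R a) (hR : ∀ a, R a → a ≤ d.n) (hX : ∀ a u, X a u → u ≤ d.n)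
    (hy : ∀ u, u ≤ d.n → d.Flat y u b → b ≤ d.n) :
    (d.next y X Z).testBit b = true ↔ ∃ a u, R a ∧ X a u ∧ d.Flat y u b := by
  rw [next, testBit_bitCode]
  constructor
  · rintro ⟨-, a, -, u, -, h1, h2, h3⟩
    exact ⟨a, u, (hZ a).1 h1, h2, h3⟩
  · rintro ⟨a, u, h1, h2, h3⟩
    exact ⟨Nat.lt_succ_of_le (hy u (hX a u h2) h3), a, hR a h1, u, hX a u h2, (hZ a).2 h1, h2, h3⟩

theorem Flat.le {y u : ℕ} (hu : u ≤ d.n) (h : d.Flat y u b) : b ≤ d.n := by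
  rw [Flat, closure_iff d (fun _ _ h => h.le) hu] at h
  cases h with
  | refl => exact hu
  | tail _ h => exact h.le.2

/-- Either the counter test reveals `x`, or `x` and its representative are congruent and at least
`d.base + 2`. The margin of `2` keeps the level above `d.base` even after a decrement, as
`flat_congr` requires. -/
theorem rep_spec (d : NumOCA) (x : ℕ) :
    d.rep (min x (d.base + 2)) (x % d.period) = x ∨ d.base + 2 ≤ x ∧
      d.base + 2 ≤ d.rep (min x (d.base + 2)) (x % d.period) ∧
      d.rep (min x (d.base + 2)) (x % d.period) ≡ x [MOD d.period] := by
  unfold rep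
  split_ifs with h
  · left; omega
  · have h1 : 1 * (d.base + 2) ≤ d.period * (d.base + 2) :=
      Nat.mul_le_mul_right _ d.period_spec.1
    refine .inr ⟨by omega, by omega, ?_⟩
    rw [Nat.ModEq, Nat.add_mul_mod_self_left, Nat.mod_mod]

/-- What a state `i` at the counter value `x` says about the observation `w`. -/
def Inv (d : NumOCA) (e : α → ℕ) (w : List (α × ℕ)) (i x : ℕ) : Prop :=
  i % 4 ≠ 3 → (∀ b, (d.setOf i).testBit b = true ↔ Reach d e w b x) ∧ d.resOf i = x % d.period ∧
    (i % 4 = 0 → x = level w) ∧ (i % 4 = 1 → level w ≤ x) ∧ (i % 4 = 2 → x ≤ level w)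

theorem Inv.start (hq : d.q0 < d.n) : Inv d e [] d.detStart 0 := by
  intro _
  have hp := d.period_spec.1
  refine ⟨fun b => ?_, ?_, fun _ => rfl, fun _ => le_rfl, fun _ => le_rfl⟩
  · rw [detStart, setOf_pack (by omega) hp, testBit_bitCode, reach_nil_iff hq]
    exact and_iff_right_of_imp fun h => Nat.lt_succ_of_le (h.le hq.le)
  · rw [detStart, resOf_pack (by omega) hp, Nat.zero_mod]

theorem Inv.pack {Z c k : ℕ} (hk : k < 3) (hc : c = x % d.period)
    (hZ : ∀ b, Z.testBit b = true ↔ Reach d e w b x) (h0 : k = 0 → x = level w)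
    (h1 : k = 1 → level w ≤ x) (h2 : k = 2 → x ≤ level w) : Inv d e w (d.pack Z c k) x := by
  have hlt : c < d.period := hc ▸ Nat.mod_lt _ d.period_spec.1
  intro _
  rw [setOf_pack (by omega) hlt, resOf_pack (by omega) hlt, pack_mod (by omega)]
  exact ⟨hZ, hc, h0, h1, h2⟩

theorem Inv.fail : Inv d e w 3 x := fun h => absurd rfl h

theorem Inv.letterSucc (hq : d.q0 < d.n) (h : Inv d e w i x) (l : α) :
    Inv d e (w ++ [(l, x)])
      (d.letterSucc i (d.rep (min x (d.base + 2)) (d.resOf i)) (e l)) x := by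
  unfold NumOCA.letterSucc
  split_ifs with h3
  · exact .fail
  obtain ⟨hZ, hr, -⟩ := h h3
  have hm : d.m ≤ d.base := Nat.le_add_right _ _
  have hrep := d.rep_spec x
  rw [← hr] at hrep
  refine .pack (by omega) hr (fun b => ?_) (fun _ => (level_append w l x).symm)
    (by omega) (by omega)
  rw [testBit_next hZ (fun a ha => ha.le hq) (fun a u hu => hu.2.1.le) fun u hu h => h.le hu,
    reach_append_iff]
  rcases hrep with hrep | ⟨h1, h2, h4⟩
  · rw [hrep]
  · rw [d.flat_congr (by omega) (by omega) h4, show min (d.rep (min x (d.base + 2)) (d.resOf i)) d.m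
      = min x d.m by omega]

/-- The modes `0` and `1` provide `level w ≤ x`, which `reach_succ_iff` needs; all other modes lead
to failure, where nothing is claimed. -/
theorem Inv.incSucc (hq : d.q0 < d.n) (h : Inv d e w i x) :
    Inv d e w (d.incSucc i (d.rep (min x (d.base + 2)) (d.resOf i))) (x + 1) := by
  unfold NumOCA.incSucc
  split_ifs with h3
  · exact .fail
  obtain ⟨hZ, hr, h0, h1, -⟩ := h (by omega)
  have hx : level w ≤ x := by
    rcases (show i % 4 = 0 ∨ i % 4 = 1 by omega) with h | h
    · exact (h0 h).ge
    · exact h1 h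
  have hm : d.m ≤ d.base := Nat.le_add_right _ _
  have hrep := d.rep_spec x
  rw [← hr] at hrep
  refine .pack (by omega) (by rw [hr, Nat.mod_add_mod]) (fun b => ?_) (by omega) (by omega)
    (by omega)
  rw [testBit_next hZ (fun a ha => ha.le hq) (fun a u hu => hu.le.2) fun u hu h => h.le hu,
    reach_succ_iff hx]
  rcases hrep with hrep | ⟨h1, h2, h4⟩
  · rw [hrep]
  · rw [d.flat_congr (by omega) (by omega) (h4.add_right 1),
      d.inc_congr (show min (d.rep (min x (d.base + 2)) (d.resOf i)) d.m = min x d.m by omega)]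

theorem Inv.decSucc (hq : d.q0 < d.n) (h : Inv d e w i (x + 1)) :
    Inv d e w (d.decSucc i (d.rep (min (x + 1) (d.base + 2)) (d.resOf i))) x := by
  unfold NumOCA.decSucc
  split_ifs with h3
  · exact .fail
  obtain ⟨hZ, hr, h0, -, h1⟩ := h (by omega)
  have hx : x < level w := by
    rcases (show i % 4 = 0 ∨ i % 4 = 2 by omega) with h | h
    · exact (h0 h).le
    · exact h1 h
  have hm : d.m ≤ d.base := Nat.le_add_right _ _
  have hp := d.period_spec.1
  have hrep := d.rep_spec (x + 1)
  rw [← hr] at hrep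
  refine .pack (by omega) ?_ (fun b => ?_) (by omega) (by omega) (by omega)
  -- Adding `d.period - 1` subtracts one modulo the period.
  · rw [hr, Nat.mod_add_mod, show x + 1 + (d.period - 1) = x + d.period by omega,
      Nat.add_mod_right]
  rw [testBit_next hZ (fun a ha => ha.le hq) (fun a u hu => hu.le.2) fun u hu h => h.le hu,
    reach_pred_iff hx]
  rcases hrep with hrep | ⟨h1, h2, h4⟩
  · rw [hrep, Nat.add_sub_cancel]
  · have h5 : d.rep (min (x + 1) (d.base + 2)) (d.resOf i) - 1 ≡ x [MOD d.period] := by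
      refine Nat.ModEq.add_right_cancel' 1 ?_
      rwa [show d.rep (min (x + 1) (d.base + 2)) (d.resOf i) - 1 + 1 =
        d.rep (min (x + 1) (d.base + 2)) (d.resOf i) by omega]
    rw [d.flat_congr (by omega) (by omega) h5, d.dec_congr
      (show min (d.rep (min (x + 1) (d.base + 2)) (d.resOf i)) d.m = min (x + 1) d.m by omega)]

end Invariant

/-! #### The deterministic automaton -/

section Det

variable {α : Type v}

/-- The number of a symbol, if the letters are numbered by `e`. -/
def symbolIndex (d : NumOCA) (e : α → ℕ) : OCA.Symbol α → ℕ
  | .inl l => e l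
  | .inr .inc => d.s
  | .inr .dec => d.s + 1

/-- The deterministic automaton for the complement. -/
noncomputable def detOCA (d : NumOCA) (e : α → ℕ) : OCA (Fin d.detCard) α where
  start := ⟨d.detStart, d.detStart_lt⟩
  final := {i | d.DetFinal i}
  threshold := d.base + 2
  trans := {t | (t.2.2.2 : ℕ) = d.delta t.1 t.2.1 (d.symbolIndex e t.2.2.1)}

variable {d : NumOCA} {e : α → ℕ}

theorem detOCA_deterministic : (d.detOCA e).Deterministic := fun q k σ =>
  ⟨⟨d.delta q k (d.symbolIndex e σ), d.delta_lt _ _ _⟩, rfl, fun _ h => Fin.ext h⟩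

theorem delta_letter (he : ∀ l, e l < d.s) (i k : ℕ) (l : α) :
    d.delta i k (e l) = d.letterSucc i (d.rep k (d.resOf i)) (e l) := if_pos (he l)

theorem delta_inc (i k : ℕ) : d.delta i k d.s = d.incSucc i (d.rep k (d.resOf i)) := by
  simp [delta]

theorem delta_dec (i k : ℕ) : d.delta i k (d.s + 1) = d.decSucc i (d.rep k (d.resOf i)) := by
  simp [delta]

theorem Inv.step (hq : d.q0 < d.n) (he : ∀ l, e l < d.s) {w : List (α × ℕ)}
    {c c' : Fin d.detCard × ℕ} {t : OCA.Label α} (h : Inv d e w c.1 c.2)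
    (hs : (d.detOCA e).Step c t c') : Inv d e (w ++ OCA.obs t) c'.1 c'.2 := by
  cases hs with
  | @inc q q' x hs =>
    have hs : (q' : ℕ) = d.delta q ((d.detOCA e).test x) d.s := hs
    rw [delta_inc] at hs
    rw [show OCA.obs (.inr .inc : OCA.Label α) = [] from rfl, List.append_nil]
    dsimp only
    rw [hs]
    exact h.incSucc hq
  | @dec q q' x hs =>
    have hs : (q' : ℕ) = d.delta q ((d.detOCA e).test (x + 1)) (d.s + 1) := hs
    rw [delta_dec] at hs
    rw [show OCA.obs (.inr .dec : OCA.Label α) = [] from rfl, List.append_nil]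
    dsimp only
    rw [hs]
    exact h.decSucc hq
  | @letter q q' x l hs =>
    have hs : (q' : ℕ) = d.delta q ((d.detOCA e).test x) (e l) := hs
    rw [delta_letter he] at hs
    change Inv d e (w ++ [(l, x)]) q' x
    rw [hs]
    exact h.letterSucc hq l

theorem Inv.run (hq : d.q0 < d.n) (he : ∀ l, e l < d.s) {w : List (α × ℕ)}
    {c c' : Fin d.detCard × ℕ} {τ : List (OCA.Label α)} (h : Inv d e w c.1 c.2)
    (hs : (d.detOCA e).PartialRun c τ c') : Inv d e (w ++ τ.flatMap OCA.obs) c'.1 c'.2 := by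
  induction hs generalizing w with
  | nil => simpa using h
  | cons hs _ ih =>
    rw [List.flatMap_cons, ← List.append_assoc]
    exact ih (h.step hq he hs)

end Det

end NumOCA

/-! ### Concatenation of runs. -/

namespace OCA

variable {Q : Type u} {α : Type v} {A : OCA Q α}

theorem PartialRun.append {c c' c'' : Q × ℕ} {τ τ' : List (Label α)} (h : A.PartialRun c τ c')
    (h' : A.PartialRun c' τ' c'') : A.PartialRun c (τ ++ τ') c'' := by
  induction h with
  | nil => exact h'
  | cons hs _ ih => exact .cons hs (ih h')

theorem PartialRun.snoc {c c' c'' : Q × ℕ} {τ : List (Label α)} {l : Label α}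
    (h : A.PartialRun c τ c') (h' : A.Step c' l c'') : A.PartialRun c (τ ++ [l]) c'' :=
  h.append (.cons h' (.nil _))

end OCA

/-! ### Existence of runs and the language of the deterministic automaton. -/

namespace NumOCA

section Det

variable {α : Type v} {d : NumOCA} {e : α → ℕ}

/-- Increments lead from the modes `0` and `1` to mode `1`, hence never to failure. -/
theorem exists_run_inc (k : ℕ) (i : Fin d.detCard) (hi : (i : ℕ) % 4 < 2) (y : ℕ) :
    ∃ (τ : List (OCA.Label α)) (i' : Fin d.detCard), (d.detOCA e).PartialRun (i, y) τ (i', y + k) ∧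
      τ.flatMap OCA.obs = [] ∧ (i' : ℕ) % 4 < 2 := by
  induction k with
  | zero => exact ⟨[], i, .nil _, rfl, hi⟩
  | succ k ih =>
    obtain ⟨τ, i', h1, h2, h3⟩ := ih
    refine ⟨_, ⟨d.delta i' ((d.detOCA e).test (y + k)) d.s, d.delta_lt _ _ _⟩,
      h1.snoc (.inc (by exact rfl)), by simp [h2, OCA.obs], ?_⟩
    simp only [delta_inc, incSucc]
    rw [if_neg (by omega), pack_mod (by omega)]
    omega

/-- The even modes are `0` and `2`, and decrements lead from them to mode `2`. -/
theorem exists_run_dec (k : ℕ) (i : Fin d.detCard) (hi : (i : ℕ) % 2 = 0) (y : ℕ) :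
    ∃ (τ : List (OCA.Label α)) (i' : Fin d.detCard), (d.detOCA e).PartialRun (i, y + k) τ (i', y) ∧
      τ.flatMap OCA.obs = [] ∧ (i' : ℕ) % 2 = 0 := by
  induction k generalizing i with
  | zero => exact ⟨[], i, .nil _, rfl, hi⟩
  | succ k ih =>
    obtain ⟨τ, i', h1, h2, h3⟩ := ih
      ⟨d.delta i ((d.detOCA e).test (y + k + 1)) (d.s + 1), d.delta_lt _ _ _⟩ (by
        simp only [delta_dec, decSucc]
        rw [if_neg (by omega)]
        have := pack_mod (d := d) (k := 2) (by omega)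
          (Z := d.next (d.rep ((d.detOCA e).test (y + k + 1)) (d.resOf i) - 1)
            (d.Dec (d.rep ((d.detOCA e).test (y + k + 1)) (d.resOf i))) (d.setOf i))
          (c := (d.resOf i + (d.period - 1)) % d.period)
        omega)
    exact ⟨_, i', .cons (.dec (by exact rfl)) h1, by simp [h2, OCA.obs], h3⟩

theorem exists_run (he : ∀ l, e l < d.s) (w : List (α × ℕ)) :
    ∃ (τ : List (OCA.Label α)) (i : Fin d.detCard),
      (d.detOCA e).PartialRun ((d.detOCA e).start, 0) τ (i, level w) ∧
      τ.flatMap OCA.obs = w ∧ (i : ℕ) % 4 = 0 := by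
  induction w using List.reverseRecOn with
  | nil => exact ⟨[], _, .nil _, rfl, pack_mod (by omega)⟩
  | append_singleton w p ih =>
    obtain ⟨l, x⟩ := p
    obtain ⟨τ, i, h1, h2, h3⟩ := ih
    obtain ⟨τ', i', h4, h5, h6⟩ : ∃ (τ' : List (OCA.Label α)) (i' : Fin d.detCard),
        (d.detOCA e).PartialRun (i, level w) τ' (i', x) ∧ τ'.flatMap OCA.obs = [] ∧
        (i' : ℕ) % 4 ≠ 3 := by
      rcases le_total (level w) x with h | h
      · obtain ⟨k, hk⟩ := Nat.exists_eq_add_of_le h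
        obtain ⟨τ', i', h4, h5, h6⟩ := exists_run_inc (e := e) k i (by omega) (level w)
        exact ⟨τ', i', hk ▸ h4, h5, by omega⟩
      · obtain ⟨k, hk⟩ := Nat.exists_eq_add_of_le h
        obtain ⟨τ', i', h4, h5, h6⟩ := exists_run_dec (e := e) k i (by omega) x
        exact ⟨τ', i', hk ▸ h4, h5, by omega⟩
    refine ⟨_, ⟨d.delta i' ((d.detOCA e).test x) (e l), d.delta_lt _ _ _⟩,
      (h1.append h4).snoc (c'' := (_, level (w ++ [(l, x)]))) (l := .inl (l, x)) ?_, ?_, ?_⟩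
    · rw [level_append]
      exact .letter (by exact rfl)
    · simp [h2, h5, OCA.obs]
    · simp only [delta_letter he, letterSucc]
      rw [if_neg h6, pack_mod (by omega)]

/-- An accepting run ends in mode `0`, where the invariant says that the counter value is `level w`
and that the state codes the reachable set. Conversely, the run of `exists_run` ends in mode `0`, so
it accepts as soon as `d.n` is missing from the set. -/
theorem mem_obsLanguage_detOCA (hq : d.q0 < d.n) (he : ∀ l, e l < d.s) {w : List (α × ℕ)} :
    w ∈ (d.detOCA e).obsLanguage ↔ ¬ Reach d e w d.n (level w) := by
  have hstart : Inv d e [] ((d.detOCA e).start : ℕ) 0 := .start hq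
  constructor
  · rintro ⟨τ, ⟨i, x⟩, hrun, ⟨h0, hfin⟩, rfl⟩
    have h := hstart.run hq he (c := ((d.detOCA e).start, 0)) hrun
    dsimp only at h0 hfin h
    obtain ⟨hZ, -, hx, -⟩ := h (by omega)
    rw [List.nil_append] at hZ hx
    rwa [← hx h0, ← hZ]
  · intro hw
    obtain ⟨τ, i, hrun, rfl, h0⟩ := exists_run he w
    refine ⟨τ, _, hrun, ⟨h0, ?_⟩, rfl⟩
    have h := hstart.run hq he (c := ((d.detOCA e).start, 0)) hrun
    dsimp only at h ⊢
    obtain ⟨hZ, -⟩ := h (by omega)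
    rwa [hZ, List.nil_append]

end Det

end NumOCA

/-! ### Lists of bits as numbers -/

/-- The number with the given binary digits, the lowest one first. -/
def listCode : List ℕ → ℕ
  | [] => 0
  | b :: l => b + 2 * listCode l

theorem testBit_listCode {l : List ℕ} (hl : ∀ b ∈ l, b ≤ 1) (i : ℕ) :
    (listCode l).testBit i = true ↔ l[i]? = some 1 := by
  induction l generalizing i with
  | nil => simp [listCode]
  | cons b l ih =>
    have hb := hl b List.mem_cons_self
    have ih := ih fun b hb => hl b (List.mem_cons_of_mem _ hb)
    cases i with
    | zero =>
      rw [Nat.testBit_zero, listCode, decide_eq_true_iff, List.getElem?_cons_zero,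
        Option.some.injEq]
      omega
    | succ i =>
      rw [Nat.testBit_succ, listCode, show (b + 2 * listCode l) / 2 = listCode l by omega, ih,
        List.getElem?_cons_succ]

theorem listCode_lt {l : List ℕ} (hl : ∀ b ∈ l, b ≤ 1) : listCode l < 2 ^ l.length := by
  induction l with
  | nil => simp [listCode]
  | cons b l ih =>
    have hb := hl b List.mem_cons_self
    have ih := ih fun b hb => hl b (List.mem_cons_of_mem _ hb)
    rw [listCode, List.length_cons, pow_succ]
    omega

theorem listCode_append (l : List ℕ) (b : ℕ) :
    listCode (l ++ [b]) = listCode l + b * 2 ^ l.length := by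
  induction l with
  | nil => simp [listCode]
  | cons a l ih => rw [List.cons_append, listCode, ih, listCode, List.length_cons, pow_succ]; ring

theorem getElem?_flatMap_of_length {β γ : Type*} {K : ℕ} (f : β → List γ)
    (hf : ∀ b, (f b).length = K) (l : List β) (i j : ℕ) (hj : j < K) :
    (l.flatMap f)[i * K + j]? = l[i]?.bind fun b => (f b)[j]? := by
  induction l generalizing i with
  | nil => simp
  | cons b l ih =>
    rw [List.flatMap_cons]
    cases i with
    | zero => rw [zero_mul, zero_add, List.getElem?_append_left (by rw [hf]; exact hj)]; simp
    | succ i =>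
      rw [Nat.succ_mul, List.getElem?_append_right (by rw [hf]; omega), hf,
        show i * K + K + j - K = i * K + j by omega, ih]
      simp

theorem length_flatMap_of_length {β γ : Type*} {K : ℕ} (f : β → List γ)
    (hf : ∀ b, (f b).length = K) (l : List β) : (l.flatMap f).length = l.length * K := by
  induction l with
  | nil => simp
  | cons b l ih => rw [List.flatMap_cons, List.length_append, ih, hf, List.length_cons]; ring

namespace OCA

variable {Q : Type u} {α : Type v}

/-! ### The bits of an encoding and their positions. -/

section Encoding

variable (A : OCA Q α) {n s : ℕ} (eQ : Q ≃ Fin n) (eA : α ≃ Fin s)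

/-- The bits in the encoding of an automaton. -/
noncomputable def bits : List ℕ :=
  (List.finRange n).map (fun i => bit (eQ.symm i ∈ A.final)) ++
  (List.finRange n).flatMap fun i =>
    (List.finRange (A.threshold + 1)).flatMap fun k =>
      (symbols eA).flatMap fun σ =>
        (List.finRange n).map fun j => bit ((eQ.symm i, k, σ, eQ.symm j) ∈ A.trans)

theorem encode_eq : A.encode eQ eA = n :: s :: A.threshold :: (eQ A.start : ℕ) :: A.bits eQ eA := by
  simp [encode, bits]

theorem bits_le {b : ℕ} (hb : b ∈ A.bits eQ eA) : b ≤ 1 := by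
  simp only [bits, List.mem_append, List.mem_map, List.mem_flatMap] at hb
  obtain ⟨i, -, rfl⟩ | ⟨i, -, k, -, σ, -, j, -, rfl⟩ := hb <;> exact RAM.bit_le_one _

theorem length_symbols : (symbols eA).length = s + 2 := by simp [symbols]

theorem length_bits :
    (A.bits eQ eA).length = n + n * ((A.threshold + 1) * ((s + 2) * n)) := by
  rw [bits, List.length_append, List.length_map, List.length_finRange,
    length_flatMap_of_length (K := (A.threshold + 1) * ((s + 2) * n)), List.length_finRange]
  intro i
  rw [length_flatMap_of_length (K := (s + 2) * n), List.length_finRange]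
  intro k
  rw [length_flatMap_of_length (K := n), length_symbols]
  simp

/-- The description of an automaton by numbers. -/
noncomputable def toNum (hs : 0 < s) : NumOCA where
  n := n
  s := s
  m := A.threshold
  q0 := eQ A.start
  c := listCode (A.bits eQ eA)
  n_pos := (eQ A.start).pos
  s_pos := hs

variable {A eQ eA} {hs : 0 < s}

theorem getElem?_symbols (σ : Symbol α) :
    (symbols eA)[(A.toNum eQ eA hs).symbolIndex (fun l => (eA l : ℕ)) σ]? = some σ := by
  rcases σ with l | _ | _
  · rw [symbols, List.getElem?_append_left (by simp [NumOCA.symbolIndex])]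
    simp [NumOCA.symbolIndex]
  · rw [symbols, List.getElem?_append_right (by simp [NumOCA.symbolIndex, toNum])]
    simp [NumOCA.symbolIndex, toNum]
  · rw [symbols, List.getElem?_append_right (by simp [NumOCA.symbolIndex, toNum])]
    simp [NumOCA.symbolIndex, toNum]

theorem symbolIndex_lt (σ : Symbol α) :
    (A.toNum eQ eA hs).symbolIndex (fun l => (eA l : ℕ)) σ < s + 2 := by
  rcases σ with l | _ | _
  · have := (eA l).isLt
    simp only [NumOCA.symbolIndex]
    omega
  · simp [NumOCA.symbolIndex, toNum]
  · simp [NumOCA.symbolIndex, toNum]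

theorem bit_eq_one {p : Prop} : bit p = 1 ↔ p := by by_cases h : p <;> simp [bit, h]

theorem testBit_final (i : Fin n) :
    (A.toNum eQ eA hs).c.testBit i = true ↔ eQ.symm i ∈ A.final := by
  rw [toNum, testBit_listCode fun b hb => A.bits_le eQ eA hb, bits,
    List.getElem?_append_left (by simp)]
  simp [bit_eq_one]

theorem trans_iff {q q' : Q} {k : Fin (A.threshold + 1)} {σ : Symbol α} :
    (A.toNum eQ eA hs).Trans k ((A.toNum eQ eA hs).symbolIndex (fun l => (eA l : ℕ)) σ)
      (eQ q) (eQ q') ↔ (q, k, σ, q') ∈ A.trans := by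
  have hσ := getElem?_symbols (A := A) (eQ := eQ) (eA := eA) (hs := hs) σ
  have hlt := symbolIndex_lt (A := A) (eQ := eQ) (eA := eA) (hs := hs) σ
  set j := (A.toNum eQ eA hs).symbolIndex (fun l => (eA l : ℕ)) σ
  -- The position of a transition bit is a mixed-radix number with the digits `q`, `k`, `j`, `q'`;
  -- `h3` and `h2` exclude an overflow of the lower digits.
  have h3 : j * n + (eQ q' : ℕ) < (s + 2) * n := by
    have h1 := Nat.mul_le_mul_right n (show j + 1 ≤ s + 2 from hlt)
    have := (eQ q').isLt
    rw [Nat.succ_mul] at h1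
    omega
  have h2 : (k : ℕ) * ((s + 2) * n) + (j * n + (eQ q' : ℕ)) <
      (A.threshold + 1) * ((s + 2) * n) := by
    have := Nat.mul_le_mul_right ((s + 2) * n) (show (k : ℕ) + 1 ≤ A.threshold + 1 from k.isLt)
    rw [Nat.succ_mul] at this
    omega
  have hidx : n + ((((eQ q : ℕ) * (A.threshold + 1) + k) * (s + 2) + j) * n + (eQ q' : ℕ)) =
      n + ((eQ q : ℕ) * ((A.threshold + 1) * ((s + 2) * n)) +
        ((k : ℕ) * ((s + 2) * n) + (j * n + (eQ q' : ℕ)))) := by ring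
  have hbit : (A.toNum eQ eA hs).c.testBit
      (n + ((((eQ q : ℕ) * (A.threshold + 1) + k) * (s + 2) + j) * n + (eQ q' : ℕ))) = true ↔
      (q, k, σ, q') ∈ A.trans := by
    rw [toNum, testBit_listCode fun b hb => A.bits_le eQ eA hb, bits, hidx,
      List.getElem?_append_right (by simp), List.length_map, List.length_finRange,
      Nat.add_sub_cancel_left,
      getElem?_flatMap_of_length (K := (A.threshold + 1) * ((s + 2) * n)) _ ?_ _ _ _ h2]
    · rw [List.getElem?_eq_getElem (by simp), Option.bind_some,
        getElem?_flatMap_of_length (K := (s + 2) * n) _ ?_ _ _ _ h3]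
      · rw [List.getElem?_eq_getElem (by simpa using k.is_le), Option.bind_some,
          getElem?_flatMap_of_length (K := n) _ ?_ _ _ _ (eQ q').isLt, hσ]
        · simp [bit_eq_one]
        · simp
      · intro k
        rw [length_flatMap_of_length (K := n), length_symbols]
        simp
    · intro i
      rw [length_flatMap_of_length (K := (s + 2) * n), List.length_finRange]
      intro k
      rw [length_flatMap_of_length (K := n), length_symbols]
      simp
  exact (and_iff_right (eQ q).isLt).trans ((and_iff_right (eQ q').isLt).trans hbit)

end Encoding

/-! ### The language of an automaton and that of its description -/

section Language

variable {A : OCA Q α} {n s : ℕ} {eQ : Q ≃ Fin n} {eA : α ≃ Fin s} {hs : 0 < s}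

theorem reach_step {w : List (α × ℕ)} {c c' : Q × ℕ} {l : Label α} (h : A.Step c l c')
    (hr : (A.toNum eQ eA hs).Reach (fun l => (eA l : ℕ)) w (eQ c.1) c.2) :
    (A.toNum eQ eA hs).Reach (fun l => (eA l : ℕ)) (w ++ obs l) (eQ c'.1) c'.2 := by
  cases h with
  | @inc q q' x h =>
    rw [show obs (.inr .inc : Label α) = [] from rfl, List.append_nil]
    exact hr.inc (.inl ((trans_iff (A := A) (eQ := eQ) (eA := eA) (hs := hs)
      (k := A.test x) (σ := .inr .inc)).2 h))
  | @dec q q' x h =>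
    rw [show obs (.inr .dec : Label α) = [] from rfl, List.append_nil]
    exact hr.dec (.inl ((trans_iff (A := A) (eQ := eQ) (eA := eA) (hs := hs) (k := A.test (x + 1))
      (σ := .inr .dec)).2 h))
  | @letter q q' x a h =>
    exact hr.letter (l := a) ((trans_iff (A := A) (eQ := eQ) (eA := eA) (hs := hs)
      (k := A.test x) (σ := .inl a)).2 h)

theorem reach_run {w : List (α × ℕ)} {c c' : Q × ℕ} {τ : List (Label α)}
    (h : A.PartialRun c τ c')
    (hr : (A.toNum eQ eA hs).Reach (fun l => (eA l : ℕ)) w (eQ c.1) c.2) :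
    (A.toNum eQ eA hs).Reach (fun l => (eA l : ℕ)) (w ++ τ.flatMap obs) (eQ c'.1) c'.2 := by
  induction h generalizing w with
  | nil => simpa using hr
  | cons h _ ih =>
    rw [List.flatMap_cons, ← List.append_assoc]
    exact ih (reach_step h hr)

/-- The extra state `n` is entered only from a final state, is never left and reads no letter. Once
it is reached, the observation so far is accepted and does not change any more. -/
theorem exists_run_of_reach {w : List (α × ℕ)} {b x : ℕ}
    (h : (A.toNum eQ eA hs).Reach (fun l => (eA l : ℕ)) w b x) :
    (∃ q τ, (eQ q : ℕ) = b ∧ A.PartialRun (A.start, 0) τ (q, x) ∧ τ.flatMap obs = w) ∨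
      (b = n ∧ w ∈ A.obsLanguage) := by
  have key : ∀ {k : Fin (A.threshold + 1)} {σ : Symbol α} {q : Q} {b : ℕ},
      (A.toNum eQ eA hs).Trans k ((A.toNum eQ eA hs).symbolIndex (fun l => (eA l : ℕ)) σ)
        (eQ q) b → ∃ q', (eQ q' : ℕ) = b ∧ (q, k, σ, q') ∈ A.trans := by
    intro k σ q b ht
    refine ⟨eQ.symm ⟨b, ht.2.1⟩, by simp, ?_⟩
    refine (trans_iff (A := A) (eQ := eQ) (eA := eA) (hs := hs)).1 ?_
    simpa using ht
  induction h with
  | start => exact .inl ⟨A.start, [], rfl, .nil _, rfl⟩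
  | @inc w a b x _ ht ih =>
    rcases ih with ⟨q, τ, rfl, hrun, rfl⟩ | ⟨rfl, hw⟩
    · rcases ht with ht | ⟨rfl, ht | ⟨-, ht⟩⟩
      · obtain ⟨q', hq', ht'⟩ := key (σ := .inr .inc) (k := A.test x) ht
        exact .inl ⟨q', _, hq', hrun.snoc (.inc ht'), by simp [obs]⟩
      · exact absurd ht (eQ q).isLt.ne
      · rw [testBit_final, Equiv.symm_apply_apply] at ht
        exact .inr ⟨rfl, τ, _, hrun, ht, rfl⟩
    · rcases ht with ht | ⟨rfl, -⟩
      · exact absurd ht.1 (lt_irrefl _)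
      · exact .inr ⟨rfl, hw⟩
  | @dec w a b x _ ht ih =>
    rcases ih with ⟨q, τ, rfl, hrun, rfl⟩ | ⟨rfl, hw⟩
    · rcases ht with ht | ⟨-, ht⟩
      · obtain ⟨q', hq', ht'⟩ := key (σ := .inr .dec) (k := A.test (x + 1)) ht
        exact .inl ⟨q', _, hq', hrun.snoc (.dec ht'), by simp [obs]⟩
      · exact absurd ht (eQ q).isLt.ne
    · rcases ht with ht | ⟨rfl, -⟩
      · exact absurd ht.1 (lt_irrefl _)
      · exact .inr ⟨rfl, hw⟩
  | @letter w a b x l _ ht ih =>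
    rcases ih with ⟨q, τ, rfl, hrun, rfl⟩ | ⟨rfl, hw⟩
    · obtain ⟨q', hq', ht'⟩ := key (σ := .inl l) (k := A.test x) ht
      exact .inl ⟨q', _, hq', hrun.snoc (.letter ht'), by simp [obs]⟩
    · exact absurd ht.1 (lt_irrefl _)

theorem mem_obsLanguage_iff_reach {w : List (α × ℕ)} : w ∈ A.obsLanguage ↔
    (A.toNum eQ eA hs).Reach (fun l => (eA l : ℕ)) w (A.toNum eQ eA hs).n (NumOCA.level w) := by
  constructor
  · rintro ⟨τ, ⟨q, x⟩, hrun, hq, rfl⟩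
    have h := reach_run (eQ := eQ) (eA := eA) (hs := hs) hrun .start
    rw [List.nil_append] at h
    generalize τ.flatMap obs = w at h ⊢
    have h1 : (A.toNum eQ eA hs).Reach (fun l => (eA l : ℕ)) w n (x + 1) :=
      h.inc (.inr ⟨rfl, .inr ⟨(eQ q).isLt, by rw [testBit_final]; simpa using hq⟩⟩)
    have hup : ∀ k, (A.toNum eQ eA hs).Reach (fun l => (eA l : ℕ)) w n (x + 1 + k) := fun k => by
      induction k with
      | zero => exact h1
      | succ k ih => exact ih.inc (.inr ⟨rfl, .inl rfl⟩)
    have hdown : ∀ k y, (A.toNum eQ eA hs).Reach (fun l => (eA l : ℕ)) w n (y + k) →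
        (A.toNum eQ eA hs).Reach (fun l => (eA l : ℕ)) w n y := fun k y hk => by
      induction k with
      | zero => exact hk
      | succ k ih => exact ih (.dec hk (.inr ⟨rfl, rfl⟩))
    -- The extra state is entered at `x + 1`. Climbing by `level w` first makes a descent by `x + 1`
    -- end exactly at `level w`, whichever of the two levels is higher.
    refine hdown (x + 1) _ ?_
    rw [Nat.add_comm]
    exact hup _
  · intro h
    rcases exists_run_of_reach h with ⟨q, -, hq, -⟩ | ⟨-, h⟩
    · exact absurd hq (eQ q).isLt.ne
    · exact h

theorem obsLanguage_detOCA :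
    ((A.toNum eQ eA hs).detOCA fun l => (eA l : ℕ)).obsLanguage = A.obsLanguageᶜ := by
  ext w
  rw [NumOCA.mem_obsLanguage_detOCA (eQ A.start).isLt fun l => (eA l).isLt, Set.mem_compl_iff,
    mem_obsLanguage_iff_reach]

theorem encode_detOCA :
    ((A.toNum eQ eA hs).detOCA fun l => (eA l : ℕ)).encode (Equiv.refl _) eA =
      (A.toNum eQ eA hs).detEncode := by
  set d := A.toNum eQ eA hs
  have hmap : ∀ {N : ℕ} (f : ℕ → List ℕ),
      (List.finRange N).flatMap (fun i : Fin N => f i) = (List.range N).flatMap f := fun {N} f => by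
    rw [← List.map_coe_finRange_eq_range, List.flatMap_map]
  have hsym : ∀ f : ℕ → List ℕ, (symbols eA).flatMap
      (fun σ => f (d.symbolIndex (fun l => (eA l : ℕ)) σ)) = (List.range (s + 2)).flatMap f := by
    intro f
    rw [List.range_succ, List.range_succ, List.flatMap_append, List.flatMap_append, symbols,
      List.flatMap_append, List.flatMap_map, ← hmap]
    simp [NumOCA.symbolIndex, d, toNum]
  rw [encode, NumOCA.detEncode]
  congr 1
  · congr 1
    rw [← hmap, List.map_eq_flatMap]
    rfl
  · rw [← hmap]
    refine List.flatMap_congr fun i _ => ?_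
    rw [show d.base + 3 = d.base + 2 + 1 from rfl, ← hmap]
    refine List.flatMap_congr fun k _ => ?_
    rw [show d.s = s from rfl, ← hsym]
    refine List.flatMap_congr fun σ _ => ?_
    rw [← hmap, List.map_eq_flatMap]
    rfl

end Language

end OCA

namespace RAM

/-! ### Reading an automaton -/

instance : Ctx Unit where
  dim := 0
  val _ _ := 0

theorem height_unit : height () = 0 := rfl

theorem height_nat (x : ℕ) : height ((), x) = x := by rw [height_prod, height_unit]; omega

theorem Runs.read {r : ℕ} {S : State} {b : ℕ} {l : List ℕ} (h : S.input = b :: l) :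
    Runs (.read r) S 1 fun S' => S'.reg r = b ∧ (∀ r' ≠ r, S'.reg r' = S.reg r') ∧
      S'.input = l ∧ S'.output = S.output := by
  refine .of_exec (.read _ _) ⟨?_, fun r' hr' => ?_, ?_, rfl⟩
  · simp [State.set, h]
  · simp [State.set, hr']
  · simp [h]

/-- Registers `4` and `5` hold the number coded by the `j` bits that were read, and `2 ^ j`. -/
def ReadInv (n s m q0 : ℕ) (l : List ℕ) (k : ℕ) (S : State) : Prop :=
  k ≤ l.length ∧ S.reg 0 = n ∧ S.reg 1 = s ∧ S.reg 2 = m ∧ S.reg 3 = q0 ∧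
    S.reg 4 = listCode (l.take (l.length - k)) ∧ S.reg 5 = 2 ^ (l.length - k) ∧ S.reg 6 = k ∧
    S.input = l.drop (l.length - k) ∧ S.output = []

/-- The lowest digit comes first, so a new bit, read into register `7`, is added with the weight `2
^ j` kept in register `5`; register `8` takes the results. The arithmetic is polynomial in numbers
below or equal to `2 ^ l.length`. -/
theorem exists_readBits : ∃ (P : Program) (C : ℕ), ∀ (n s m q0 : ℕ) (l : List ℕ) (S : State),
    (∀ b ∈ l, b ≤ 1) → ReadInv n s m q0 l l.length S →
    Runs P S ((2 ^ l.length + 2) ^ C) (ReadInv n s m q0 l 0) := by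
  have hadd : PolyTime (fun x : ((Unit × ℕ) × ℕ) × ℕ => x.1.1.2 + x.2 * x.1.2) :=
    .add (PolyTime.fst (PolyTime.fst .snd)) (.mul .snd (PolyTime.fst .snd))
  have hdouble : PolyTime (fun x : Unit × ℕ => x.2 + x.2) := .add .snd .snd
  obtain ⟨-, T₁, ⟨c₁, hT₁⟩, H₁⟩ := hadd
  obtain ⟨-, T₂, ⟨c₂, hT₂⟩, H₂⟩ := hdouble
  obtain ⟨P₁, hP₁⟩ := H₁ (fun i => if i = 0 then 4 else if i = 1 then 5 else 7) 8
    (fun i _ => by split_ifs <;> omega)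
  obtain ⟨P₂, hP₂⟩ := H₂ (fun _ => 5) 8 (fun i _ => by omega)
  have hpoly : PolyBdd (fun x : Unit × ℕ =>
      height x * ((height x + 2) ^ c₁ + (height x + 2) ^ c₂ + 4 + 1) + 1) := by
    have h2 := (PolyBdd.height (σ := Unit × ℕ)).add (.const 2)
    exact (PolyBdd.height.mul (((((h2.pow c₁).add (h2.pow c₂)).add (.const 4))).add
      (.const 1))).add (.const 1)
  obtain ⟨C, hC⟩ := hpoly
  refine ⟨.whileNonzero 6 (.seq (.read 7) (.seq P₁ (.seq (.copy 4 8) (.seq P₂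
    (.seq (.copy 5 8) (.pred 6)))))), C, fun n s m q0 l S hl hS => ?_⟩
  have hC' := hC ((), 2 ^ l.length)
  simp only [height_nat] at hC'
  refine (Runs.whileNonzero
    (B := (2 ^ l.length + 2) ^ c₁ + (2 ^ l.length + 2) ^ c₂ + 4) (ReadInv n s m q0 l) ?_ ?_
    l.length hS).mono (le_trans ?_ hC') fun _ h => h
  · rintro k S ⟨hk, h0, h1, h2, h3, h4, h5, h6, hin, hout⟩
    refine ⟨by omega, ?_⟩
    set j := l.length - (k + 1) with hj
    have hjl : j < l.length := by omega
    have hj' : l.length - k = j + 1 := by omega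
    rw [List.drop_eq_getElem_cons hjl] at hin
    have hb : l[j] ≤ 1 := hl _ (List.getElem_mem hjl)
    have hcode : listCode (l.take (j + 1)) = listCode (l.take j) + l[j] * 2 ^ j := by
      rw [List.take_succ_eq_append_getElem hjl, listCode_append, List.length_take,
        min_eq_left hjl.le]
    have hlt : listCode (l.take j) < 2 ^ j := by
      have := listCode_lt (l := l.take j) fun b hb => hl b (List.mem_of_mem_take hb)
      rwa [List.length_take, min_eq_left hjl.le] at this
    have hpow : 2 ^ j ≤ 2 ^ l.length := Nat.pow_le_pow_right (by omega) hjl.le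
    have hpos : 1 ≤ 2 ^ l.length := Nat.one_le_two_pow
    suffices hrun : Runs (.seq (.read 7) (.seq P₁ (.seq (.copy 4 8) (.seq P₂
        (.seq (.copy 5 8) (.pred 6)))))) S
        (1 + ((2 ^ l.length + 2) ^ c₁ + (1 + ((2 ^ l.length + 2) ^ c₂ + (1 + 1)))))
        (ReadInv n s m q0 l k) from hrun.mono (by omega) fun _ h => h
    refine .seq ((Runs.read hin).mono le_rfl ?_)
    rintro S₁ ⟨r1, k1, i1, o1⟩
    refine .seq ((hP₁ ((((), listCode (l.take j)), 2 ^ j), l[j]) S₁ ?_).mono ?_ ?_)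
    · intro i hi
      have hi : i < 3 := hi
      interval_cases i
      · exact (k1 4 (by omega)).trans h4
      · exact (k1 5 (by omega)).trans h5
      · exact r1
    · refine (hT₁ _).trans (Nat.pow_le_pow_left ?_ _)
      rw [height_prod, height_prod, height_prod, height_unit]
      omega
    rintro S₂ ⟨r2, k2⟩
    refine .seq (.of_exec (.copy _ _ _) (.seq ((hP₂ ((), 2 ^ j) _ ?_).mono ?_ ?_)))
    · intro i hi
      dsimp only
      rw [reg_set_of_ne _ (by omega), k2.1 5 (by omega), k1 5 (by omega), h5]
      have hi : i < 1 := hi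
      interval_cases i
      rfl
    · refine (hT₂ _).trans (Nat.pow_le_pow_left ?_ _)
      rw [height_nat]
      omega
    rintro S₃ ⟨r3, k3⟩
    refine .seq (.of_exec (.copy _ _ _) (.of_exec (.pred _ _) ?_))
    have hkeep : ∀ r < 4, S₃.reg r = S.reg r := fun r hr => by
      rw [k3.1 r (by omega), reg_set_of_ne _ (by omega), k2.1 r (by omega), k1 r (by omega)]
    refine ⟨by omega, ?_, ?_, ?_, ?_, ?_, ?_, ?_, ?_, ?_⟩
    · rw [reg_set_of_ne _ (by omega), reg_set_of_ne _ (by omega), hkeep 0 (by omega), h0]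
    · rw [reg_set_of_ne _ (by omega), reg_set_of_ne _ (by omega), hkeep 1 (by omega), h1]
    · rw [reg_set_of_ne _ (by omega), reg_set_of_ne _ (by omega), hkeep 2 (by omega), h2]
    · rw [reg_set_of_ne _ (by omega), reg_set_of_ne _ (by omega), hkeep 3 (by omega), h3]
    · rw [reg_set_of_ne _ (by omega), reg_set_of_ne _ (by omega), k3.1 4 (by omega), reg_set_self,
        r2, hj', hcode]
    · rw [reg_set_of_ne _ (by omega), reg_set_self, r3, hj', pow_succ, mul_two]
    · rw [reg_set_self, reg_set_of_ne _ (by omega), k3.1 6 (by omega),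
        reg_set_of_ne _ (by omega), k2.1 6 (by omega), k1 6 (by omega), h6, Nat.add_sub_cancel]
    · rw [hj', ← i1, ← k2.2.1]
      exact k3.2.1
    · rw [← hout, ← o1, ← k2.2.2]
      exact k3.2.2
  · rintro S ⟨-, -, -, -, -, -, -, h6, -⟩
    exact h6
  · exact Nat.add_le_add_right (Nat.mul_le_mul_right _ Nat.lt_two_pow_self.le) 1

/-- The length of the bit list is not part of the input; it is computed from `n`, `s` and `m` into
register `6`, which controls the loop. In the end the registers `0` to `5` hold the six numbers that
present a `NumOCA`. -/
theorem exists_reader : ∃ (P : Program) (C : ℕ), ∀ (n s m q0 : ℕ) (l : List ℕ), 0 < n →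
    (∀ b ∈ l, b ≤ 1) → l.length = n + n * ((m + 1) * ((s + 2) * n)) →
    Runs P ⟨n :: s :: m :: q0 :: l, fun _ => 0, []⟩ ((2 ^ l.length + 2) ^ C)
      (ReadInv n s m q0 l 0) := by
  obtain ⟨P, C, hP⟩ := exists_readBits
  have hlen : PolyTime (fun x : ((Unit × ℕ) × ℕ) × ℕ =>
      x.1.1.2 + x.1.1.2 * ((x.2 + 1) * ((x.1.2 + 2) * x.1.1.2))) := by
    have h1 : PolyTime (fun x : ((Unit × ℕ) × ℕ) × ℕ => x.1.1.2) :=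
      PolyTime.fst (PolyTime.fst .snd)
    have h2 : PolyTime (fun x : ((Unit × ℕ) × ℕ) × ℕ => x.1.2) := PolyTime.fst .snd
    exact .add h1 (.mul h1 (.mul (.succ .snd) (.mul h2.succ.succ h1)))
  obtain ⟨-, T, ⟨c, hT⟩, H⟩ := hlen
  obtain ⟨P', hP'⟩ := H (fun i => i) 6 (fun i hi => by
    have hi : i < 3 := hi
    omega)
  have hpoly : PolyBdd (fun x : Unit × ℕ =>
      1 + (1 + (1 + (1 + (1 + (1 + ((height x + 2) ^ c + (height x + 2) ^ C))))))) := by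
    have h2 := (PolyBdd.height (σ := Unit × ℕ)).add (.const 2)
    have h1 := PolyBdd.const (σ := Unit × ℕ) 1
    exact h1.add (h1.add (h1.add (h1.add (h1.add (h1.add ((h2.pow c).add (h2.pow C)))))))
  obtain ⟨C', hC'⟩ := hpoly
  refine ⟨.seq (.read 0) (.seq (.read 1) (.seq (.read 2) (.seq (.read 3) (.seq (.const 4 0)
    (.seq (.const 5 1) (.seq P' P)))))), C', fun n s m q0 l hn hl hlen => ?_⟩
  have hCl := hC' ((), 2 ^ l.length)
  simp only [height_nat] at hCl
  refine Runs.mono ?_ hCl fun _ h => h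
  refine .seq ((Runs.read rfl).mono le_rfl ?_)
  rintro S₁ ⟨r1, k1, i1, o1⟩
  refine .seq ((Runs.read i1).mono le_rfl ?_)
  rintro S₂ ⟨r2, k2, i2, o2⟩
  refine .seq ((Runs.read i2).mono le_rfl ?_)
  rintro S₃ ⟨r3, k3, i3, o3⟩
  refine .seq ((Runs.read i3).mono le_rfl ?_)
  rintro S₄ ⟨r4, k4, i4, o4⟩
  refine .seq (.of_exec (.const _ _ _) (.seq (.of_exec (.const _ _ _) ?_)))
  set S₅ := (S₄.set 4 0).set 5 1 with hS₅
  have e0 : S₅.reg 0 = n := by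
    rw [hS₅, reg_set_of_ne _ (by omega), reg_set_of_ne _ (by omega), k4 _ (by omega),
      k3 _ (by omega), k2 _ (by omega), r1]
  have e1 : S₅.reg 1 = s := by
    rw [hS₅, reg_set_of_ne _ (by omega), reg_set_of_ne _ (by omega), k4 _ (by omega),
      k3 _ (by omega), r2]
  have e2 : S₅.reg 2 = m := by
    rw [hS₅, reg_set_of_ne _ (by omega), reg_set_of_ne _ (by omega), k4 _ (by omega), r3]
  have e3 : S₅.reg 3 = q0 := by
    rw [hS₅, reg_set_of_ne _ (by omega), reg_set_of_ne _ (by omega), r4]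
  have hnl : n ≤ l.length := by omega
  have hmul : (m + 1) * (s + 2) ≤ l.length := by
    rw [hlen]
    nlinarith [Nat.mul_le_mul (Nat.mul_le_mul hn hn) (le_refl ((m + 1) * (s + 2)))]
  have hml : m ≤ l.length := by nlinarith
  have hsl : s ≤ l.length := by nlinarith
  have hlt : l.length < 2 ^ l.length := Nat.lt_two_pow_self
  refine .seq ((hP' ((((), n), s), m) S₅ ?_).mono ?_ ?_)
  · intro i hi
    have hi : i < 3 := hi
    interval_cases i
    exacts [e0, e1, e2]
  · refine (hT _).trans (Nat.pow_le_pow_left ?_ _)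
    rw [height_prod, height_prod, height_prod, height_unit]
    omega
  rintro S₆ ⟨r6, k6⟩
  refine hP n s m q0 l S₆ hl ⟨le_rfl, ?_, ?_, ?_, ?_, ?_, ?_, ?_, ?_, ?_⟩
  · rw [k6.1 _ (by omega), e0]
  · rw [k6.1 _ (by omega), e1]
  · rw [k6.1 _ (by omega), e2]
  · rw [k6.1 _ (by omega), e3]
  · rw [k6.1 _ (by omega), hS₅, reg_set_of_ne _ (by omega), reg_set_self]
    simp [listCode]
  · rw [k6.1 _ (by omega), hS₅, reg_set_self]
    simp
  · rw [r6, hlen]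
  · rw [k6.2.1]
    simpa [hS₅, State.set] using i4
  · rw [k6.2.2]
    exact o4.trans (o3.trans (o2.trans o1))

end RAM

namespace NumOCA

open RAM

/-- This turns time bounds in `height d` into time bounds in `2 ^ d.len`. -/
theorem height_le_p {d : NumOCA} (hq : d.q0 < d.n) (hc : d.c < d.p) : height d ≤ d.p := by
  have hn := d.n_pos
  have hlt : d.len < d.p := Nat.lt_two_pow_self
  have hmul : (d.m + 1) * (d.s + 2) ≤ d.len := by
    unfold len
    nlinarith [Nat.mul_le_mul (Nat.mul_le_mul hn hn) (le_refl ((d.m + 1) * (d.s + 2)))]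
  have hnl : d.n ≤ d.len := Nat.le_add_right _ _
  have hml : d.m ≤ d.len := by nlinarith
  have hsl : d.s ≤ d.len := by nlinarith
  refine Finset.sup_le fun i hi => ?_
  have hi : i < 6 := Finset.mem_range.1 hi
  interval_cases i
  · exact hnl.trans hlt.le
  · exact hsl.trans hlt.le
  · exact hml.trans hlt.le
  · exact (hq.le.trans hnl).trans hlt.le
  · exact hc.le
  · exact le_rfl

end NumOCA

/-! ### The program that computes the complement. -/

namespace OCA

theorem exists_complement_program : ∃ (P : RAM.Program) (p : Polynomial ℕ),
    ∀ (Q : Type u) (α : Type v) (n s : ℕ) (hs : 0 < s) (eQ : Q ≃ Fin n) (eA : α ≃ Fin s)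
      (A : OCA Q α), RAM.OutputsWithin P (A.encode eQ eA) (A.toNum eQ eA hs).detEncode
        (2 ^ p.eval A.size) := by
  obtain ⟨P, C, hP⟩ := RAM.exists_reader
  obtain ⟨T, ⟨c, hT⟩, H⟩ := NumOCA.polyPrint_detEncode
  obtain ⟨P', hP'⟩ := H (fun i => i) 6 fun i hi => hi
  -- The inner polynomial bounds `d.len`, with `n`, `s` and `m` replaced by the size. The `2` comes
  -- from `2 ^ d.len + 2 ≤ 2 ^ (d.len + 2)`, and the last `1` from adding the costs of reading and
  -- printing.
  refine ⟨.seq P P', (.X + .X * ((.X + 1) * ((.X + 2) * .X)) + 2) * .C (C + c) + 1,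
    fun Q α n s hs eQ eA A => ?_⟩
  have hn : 0 < n := (eQ A.start).pos
  set d := A.toNum eQ eA hs with hd
  have hlen : (A.bits eQ eA).length = d.len := A.length_bits eQ eA
  have hc : d.c < d.p := by
    have := listCode_lt fun b hb => A.bits_le eQ eA hb
    rwa [hlen] at this
  have hh : RAM.height d ≤ d.p := NumOCA.height_le_p (eQ A.start).isLt hc
  have hrun : RAM.Runs (.seq P P') ⟨A.encode eQ eA, fun _ => 0, []⟩
      ((2 ^ d.len + 2) ^ C + (2 ^ d.len + 2) ^ c) fun S => S.output = d.detEncode := by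
    rw [encode_eq]
    refine .seq ?_
    have h := hP n s A.threshold (eQ A.start) (A.bits eQ eA) hn
      (fun b hb => A.bits_le eQ eA hb) (A.length_bits eQ eA)
    rw [hlen] at h
    refine h.mono le_rfl ?_
    rintro S ⟨-, h0, h1, h2, h3, h4, h5, -, -, hout⟩
    rw [Nat.sub_zero, List.take_length] at h4
    rw [Nat.sub_zero, hlen] at h5
    refine (hP' d S fun i hi => ?_).mono ?_ ?_
    · have hi : i < 6 := hi
      interval_cases i
      exacts [h0, h1, h2, h3, h4, h5]
    · exact (hT d).trans (Nat.pow_le_pow_left (Nat.add_le_add_right hh 2) c)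
    · rintro S' ⟨-, h⟩
      rw [h, hout, List.nil_append]
  obtain ⟨t, ht, S, he, hS⟩ := hrun
  refine ⟨t, ht.trans ?_, S, he, hS⟩
  have hz : A.size = n + s + A.threshold + A.trans.ncard := by
    rw [size, Nat.card_congr eQ, Nat.card_congr eA, Nat.card_fin, Nat.card_fin]
  set z := A.size
  have hdlen : d.len ≤ z + z * ((z + 1) * ((z + 2) * z)) := by
    change n + n * ((A.threshold + 1) * ((s + 2) * n)) ≤ _
    gcongr <;> omega
  have hpow : 2 ^ d.len + 2 ≤ 2 ^ (d.len + 2) := by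
    have : 1 ≤ 2 ^ d.len := Nat.one_le_two_pow
    rw [pow_add]
    omega
  have hle : ∀ a ≤ C + c, (2 ^ d.len + 2) ^ a ≤ 2 ^ ((d.len + 2) * (C + c)) := fun a ha =>
    calc _ ≤ (2 ^ (d.len + 2)) ^ a := Nat.pow_le_pow_left hpow a
      _ = 2 ^ ((d.len + 2) * a) := (pow_mul _ _ _).symm
      _ ≤ _ := Nat.pow_le_pow_right (by omega) (Nat.mul_le_mul_left _ ha)
  calc _ ≤ 2 ^ ((d.len + 2) * (C + c)) + 2 ^ ((d.len + 2) * (C + c)) :=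
        Nat.add_le_add (hle C (by omega)) (hle c (by omega))
    _ = 2 ^ ((d.len + 2) * (C + c) + 1) := by rw [pow_succ, mul_two]
    _ ≤ _ := by
      refine Nat.pow_le_pow_right (by omega) ?_
      simp only [Polynomial.eval_add, Polynomial.eval_mul, Polynomial.eval_X, Polynomial.eval_C,
        Polynomial.eval_one, Polynomial.eval_ofNat]
      exact Nat.add_le_add_right (Nat.mul_le_mul_right _ (Nat.add_le_add_right hdlen 2)) 1

/-! ### Closure properties -/

section Closure

variable {α : Type v}

theorem isOCAObservable_compl {Q : Type u} [Finite Q] [Finite α] [Nonempty α] (A : OCA Q α) :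
    IsOCAObservable A.obsLanguageᶜ :=
  ⟨_, _, obsLanguage_detOCA (eQ := Finite.equivFin Q) (eA := Finite.equivFin α)
    (hs := Nat.card_pos)⟩

variable {ι : Type*} {Q : ι → Type*} (A : ∀ i, OCA (Q i) α)

/-- The state `q` of the union stands for the state `a` of the automaton `A i`. -/
def StandsFor (q : Option (Σ i, Q i)) (i : ι) (a : Q i) : Prop :=
  q = some ⟨i, a⟩ ∨ q = none ∧ a = (A i).start

/-- The union of a family of automata with thresholds at most `M`. -/
def union (M : ℕ) : OCA (Option (Σ i, Q i)) α where
  start := none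
  final := {q | ∃ i, ∃ a ∈ (A i).final, StandsFor A q i a}
  threshold := M
  trans := {t | ∃ i a b, StandsFor A t.1 i a ∧ t.2.2.2 = some ⟨i, b⟩ ∧
    (a, (A i).test t.2.1, t.2.2.1, b) ∈ (A i).trans}

variable {A} {M : ℕ}

theorem test_union (hM : ∀ i, (A i).threshold ≤ M) (i : ι) (x : ℕ) :
    (A i).test ((union A M).test x) = (A i).test x := by
  refine Fin.ext ?_
  have := hM i
  change min (min x M) (A i).threshold = min x (A i).threshold
  omega

theorem union_run (hM : ∀ i, (A i).threshold ≤ M) {i : ι} {c c' : Q i × ℕ} {τ : List (Label α)}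
    (h : (A i).PartialRun c τ c') {q : Option (Σ i, Q i)} (hq : StandsFor A q i c.1) :
    ∃ q', StandsFor A q' i c'.1 ∧ (union A M).PartialRun (q, c.2) τ (q', c'.2) := by
  induction h generalizing q with
  | nil => exact ⟨q, hq, .nil _⟩
  | cons hs _ ih =>
    cases hs with
    | @inc a b x hs =>
      obtain ⟨q', h1, h2⟩ := ih (.inl rfl)
      exact ⟨q', h1, .cons (.inc ⟨i, a, b, hq, rfl, (test_union hM i x).symm ▸ hs⟩) h2⟩
    | @dec a b x hs =>
      obtain ⟨q', h1, h2⟩ := ih (.inl rfl)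
      exact ⟨q', h1, .cons (.dec ⟨i, a, b, hq, rfl, (test_union hM i (x + 1)).symm ▸ hs⟩) h2⟩
    | @letter a b x l hs =>
      obtain ⟨q', h1, h2⟩ := ih (.inl rfl)
      exact ⟨q', h1, .cons (.letter ⟨i, a, b, hq, rfl, (test_union hM i x).symm ▸ hs⟩) h2⟩

theorem StandsFor.of_some {i j : ι} {a : Q i} {b : Q j}
    (h : StandsFor A (some ⟨i, a⟩) j b) : (⟨i, a⟩ : Σ i, Q i) = ⟨j, b⟩ := by
  rcases h with h | ⟨h, -⟩
  · exact Option.some.inj h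
  · cases h

/-- The component is found from the end of the run backwards. No move leads to `none`, so the state
after a move determines the component, and that of the move agrees with that of the rest. -/
theorem run_of_union (hM : ∀ i, (A i).threshold ≤ M) {c c' : Option (Σ i, Q i) × ℕ}
    {τ : List (Label α)} (h : (union A M).PartialRun c τ c') (hc : c'.1 ∈ (union A M).final) :
    ∃ i a, ∃ b ∈ (A i).final, StandsFor A c.1 i a ∧ (A i).PartialRun (a, c.2) τ (b, c'.2) := by
  induction h with
  | nil c =>
    obtain ⟨i, a, ha, h⟩ := hc
    exact ⟨i, a, a, ha, h, .nil _⟩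
  | cons hs _ ih =>
    obtain ⟨j, a', b', hb', hst, hrun⟩ := ih hc
    cases hs with
    | @inc q q' x hs =>
      obtain ⟨i, a, b, h1, h2, h3⟩ := hs
      obtain rfl : q' = some ⟨i, b⟩ := h2
      obtain ⟨rfl, h⟩ := Sigma.mk.inj hst.of_some
      obtain rfl := eq_of_heq h
      exact ⟨i, a, b', hb', h1, .cons (.inc (test_union hM i x ▸ h3)) hrun⟩
    | @dec q q' x hs =>
      obtain ⟨i, a, b, h1, h2, h3⟩ := hs
      obtain rfl : q' = some ⟨i, b⟩ := h2
      obtain ⟨rfl, h⟩ := Sigma.mk.inj hst.of_some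
      obtain rfl := eq_of_heq h
      exact ⟨i, a, b', hb', h1, .cons (.dec (test_union hM i (x + 1) ▸ h3)) hrun⟩
    | @letter q q' x l hs =>
      obtain ⟨i, a, b, h1, h2, h3⟩ := hs
      obtain rfl : q' = some ⟨i, b⟩ := h2
      obtain ⟨rfl, h⟩ := Sigma.mk.inj hst.of_some
      obtain rfl := eq_of_heq h
      exact ⟨i, a, b', hb', h1, .cons (.letter (test_union hM i x ▸ h3)) hrun⟩

theorem obsLanguage_union (hM : ∀ i, (A i).threshold ≤ M) :
    (union A M).obsLanguage = ⋃ i, (A i).obsLanguage := by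
  ext w
  rw [Set.mem_iUnion]
  constructor
  · rintro ⟨τ, c, hrun, hc, hw⟩
    obtain ⟨i, a, b, hb, ha | ⟨-, rfl⟩, h⟩ := run_of_union hM hrun hc
    · cases ha
    · exact ⟨i, τ, _, h, hb, hw⟩
  · rintro ⟨i, τ, c, hrun, hc, hw⟩
    obtain ⟨q, hq, h⟩ := union_run hM hrun (q := none) (.inr ⟨rfl, rfl⟩)
    exact ⟨τ, _, h, ⟨i, c.1, hc, hq⟩, hw⟩

end Closure

end OCA

section Closure

variable {α : Type v} [Finite α] [Nonempty α] {L L' : Set (List (α × ℕ))}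

theorem IsOCAObservable.compl (h : IsOCAObservable L) : IsOCAObservable Lᶜ := by
  obtain ⟨n, A, rfl⟩ := h
  exact A.isOCAObservable_compl

/-- Complementing twice replaces an arbitrary finite type of states by some `Fin N`. -/
theorem OCA.isOCAObservable {Q : Type u} [Finite Q] (A : OCA Q α) :
    IsOCAObservable A.obsLanguage := by
  simpa using A.isOCAObservable_compl.compl

theorem IsOCAObservable.union (h : IsOCAObservable L) (h' : IsOCAObservable L') :
    IsOCAObservable (L ∪ L') := by
  obtain ⟨n, A, rfl⟩ := h
  obtain ⟨n', A', rfl⟩ := h'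
  let B : ∀ i : Bool, OCA (Fin (bif i then n else n')) α := fun i =>
    match i with
    | true => A
    | false => A'
  have hM : ∀ i, (B i).threshold ≤ max A.threshold A'.threshold := fun i =>
    match i with
    | true => le_max_left _ _
    | false => le_max_right _ _
  have h : A.obsLanguage ∪ A'.obsLanguage = ⋃ i, (B i).obsLanguage :=
    Set.union_eq_iUnion.trans (Set.iUnion_congr fun i => by cases i <;> rfl)
  rw [h, ← OCA.obsLanguage_union hM]
  exact OCA.isOCAObservable _

theorem IsOCAObservable.inter (h : IsOCAObservable L) (h' : IsOCAObservable L') :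
    IsOCAObservable (L ∩ L') := by
  have := (h.compl.union h'.compl).compl
  rwa [← Set.compl_inter, compl_compl] at this

end Closure

theorem mainTheorem2 :
    (∃ (P : RAM.Program) (p : Polynomial ℕ),
      ∀ (Q : Type u) (α : Type v) [Nonempty α] (n s : ℕ) (eQ : Q ≃ Fin n) (eA : α ≃ Fin s)
        (A : OCA Q α),
        ∃ (N : ℕ) (B : OCA (Fin N) α),
          RAM.OutputsWithin P (A.encode eQ eA) (B.encode (Equiv.refl (Fin N)) eA)
            (2 ^ p.eval A.size) ∧
          B.Deterministic ∧
          B.obsLanguage = (A.obsLanguage)ᶜ) ∧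
    (∀ (α : Type v) [Finite α] [Nonempty α],
      (∀ L : Set (List (α × ℕ)), IsOCAObservable L → IsOCAObservable Lᶜ) ∧
      (∀ L L' : Set (List (α × ℕ)),
        IsOCAObservable L → IsOCAObservable L' → IsOCAObservable (L ∩ L')) ∧
      (∀ L L' : Set (List (α × ℕ)),
        IsOCAObservable L → IsOCAObservable L' → IsOCAObservable (L ∪ L'))) := by
  refine ⟨?_, fun α _ _ => ⟨fun L => IsOCAObservable.compl, fun L L' => IsOCAObservable.inter,
    fun L L' => IsOCAObservable.union⟩⟩
  obtain ⟨P, p, h⟩ := OCA.exists_complement_program.{u, v}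
  refine ⟨P, p, fun Q α _ n s eQ eA A => ?_⟩
  have hs : 0 < s := (eA (Classical.arbitrary α)).pos
  refine ⟨_, (A.toNum eQ eA hs).detOCA fun l => (eA l : ℕ), ?_, NumOCA.detOCA_deterministic,
    OCA.obsLanguage_detOCA⟩
  rw [OCA.encode_detOCA]
  exact h Q α n s hs eQ eA A
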